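/- **Setting.** Let $\Omega\subset\mathbb R^3$ be a convex domain that is exactly covered by a conforming mesh $\mathcal M_h$ of finitely many tetrahedra. Let $\mathcal M_h=\mathcal M_h^0\cup\mathcal M_h^c$ be a disjoint splitting, let $\Omega_0$ (the non-conducting part) be the interior of the union of the elements of $\mathcal M_h^0$, and put $\Omega_c=\Omega\setminus\overline{\Omega_0}$ (the conducting part). Let $\Gamma\subset\partial\Omega$ be relatively open, $\Gamma_D=\partial\Omega\setminus\overline\Gamma$, and let $\mathbf n$ be the outward unit normal on $\partial\Omega$. Let $\omega>0$, $\sigma_0>0$ and $\alpha>0$ be constants, let $\mu$ on $\Omega$ and $\varepsilon$ on $\Omega_0$ be measurable and bounded above and below by positive constants (for instance piecewise constant), let $\mathbf J_s\in L^2(\Omega)^3$ be (complex valued and) weakly divergence free with compact support in $\Omega_0$, and let the data satisfy $\mathbf n\times\mathbf E^{obs}\in L^2(\Gamma)^3$. Let $H_\Gamma(\mathbf{curl};\Omega)$ be the space of $\mathbf u\in L^2(\Omega)^3$ with $\nabla\times\mathbf u\in L^2(\Omega)^3$ and $\mathbf n\times\mathbf u=0$ on $\Gamma_D$, and let $$\mathbf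 X_h=\{\mathbf u_h\in H_\Gamma(\mathbf{curl};\Omega):\ \mathbf u_h|_K=a_K+b_K\times\mathbf x\ \text{ for every } K\in\mathcal M_h\}\qquad(a_K,b_K\in\mathbb C^3)$$ be the lowest order Nédélec edge element space. Let $U_h$ be the space of continuous complex valued functions on $\overline{\Omega_0}$ that are affine on every element of $\mathcal M_h^0$ and vanish on $\partial\Omega_0\setminus\Gamma$, and let $V_h$ be the space of continuous real valued functions on $\overline{\Omega_c}$ that are affine on every element of $\mathcal M_h^c$ and vanish on $\partial\Omega_c$. For $\sigma_h\in V_h$ consider the discrete state problem: find $(\mathbf E_h,\phi_h)\in\mathbf X_h\times U_h$ with $$a_h(\mathbf E_h,\mathbf F_h)+b(\nabla\phi_h,\mathbf F_h)=i\omega\int_\Omega\mathbf J_s\cdot\overline{\mathbf F_h}\,dx\quad\forall\,\mathbf F_h\in\mathbf X_h,\qquad b(\mathbf E_h,\nabla\psi_h)=0\quad\forall\,\psi_h\in U_h,$$ where $$a_h(\mathbf E,\mathbf F)=\int_\Omega\mu^{-1}\,\nabla\times\mathbf E\cdot\nabla\times\overline{\mathbf F}\,dx-i\omega\int_{\Omega_c}(\sigma_0+\sigma_h)\,\mathbf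 E\cdot\overline{\mathbf F}\,dx,\qquad b(\mathbf E,\mathbf F)=\int_{\Omega_0}\varepsilon\,\mathbf E\cdot\overline{\mathbf F}\,dx .$$ Fix a lower bound $\sigma_{\min}\in[0,\sigma_0]$ for the total conductivity, and let $$V_h^{ad}=\{\sigma_h\in V_h:\ \sigma_0+\sigma_h\ge\sigma_{\min}\ \text{ in }\Omega_c\};$$ for $\sigma_{\min}=0$ these are all discrete conductivities for which the total conductivity is nonnegative. **Theorem (discrete existence).** For every $\sigma_h\in V_h^{ad}$ the discrete state problem has a solution $(\mathbf E_h,\phi_h)$. Moreover, the regularized discrete problem $$\min\ \Phi_\alpha=\tfrac12\,\|\mathbf n\times(\mathbf E_h-\mathbf E^{obs})\|^2_{L^2(\Gamma)}+\tfrac\alpha2\,\|\nabla\sigma_h\|^2_{L^2(\Omega_c)}$$ over all $\sigma_h\in V_h^{ad}$, where $\mathbf E_h=\mathbf E_h(\sigma_h)$ is a solution of the discrete state problem for $\sigma_h$, has at least one minimizer: there are $\sigma_h^*\in V_h^{ad}$ and a solution $(\mathbf E_h^*,\phi_h^*)$ of the discrete state problem for $\sigma_h^*$ such that $\Phi_\alpha(\sigma_h^*,\mathbf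 E_h^*)\le\Phi_\alpha(\sigma_h,\mathbf E_h)$ for every $\sigma_h\in V_h^{ad}$ and every solution $(\mathbf E_h,\phi_h)$ of the discrete state problem for $\sigma_h$. -/

import Mathlib

open MeasureTheory Set
open scoped Matrix

noncomputable section

namespace EddyCurrent

/-- Physical space `ℝ³` with the Euclidean metric. -/
abbrev E3 : Type := EuclideanSpace ℝ (Fin 3)

/-- Values of the complex vector fields. The `L²` integrands below are written with coordinates,
so the choice of norm on this type only enters through the notion of square integrability, which
does not depend on it. -/
abbrev C3 : Type := Fin 3 → ℂ

/-! ### Differential operators -/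

/-- The partial derivative `∂ⱼ φ` of a complex valued function. -/
def pd (j : Fin 3) (φ : E3 → ℂ) (x : E3) : ℂ :=
  fderiv ℝ φ x (EuclideanSpace.single j (1 : ℝ))

/-- The gradient of a complex valued function. -/
def grad (φ : E3 → ℂ) (x : E3) : C3 := fun j => pd j φ x

/-- The curl of a complex vector field. -/
def curl (u : E3 → C3) (x : E3) : C3 :=
  ![pd 1 (fun y => u y 2) x - pd 2 (fun y => u y 1) x,
    pd 2 (fun y => u y 0) x - pd 0 (fun y => u y 2) x,
    pd 0 (fun y => u y 1) x - pd 1 (fun y => u y 0) x]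

/-- The coordinates of a real point or vector, viewed in `ℂ³`. -/
def toC3 (x : E3) : C3 := fun i => ((x i : ℝ) : ℂ)

/-! ### The mesh and the domains -/

/-- A conforming tetrahedral mesh, every element of which is assigned either to the
non-conducting region (`air`) or to the conducting region (`conductor`). An element is given by
the set of its four vertices; the closed tetrahedron is the convex hull of that set. Two elements
meet exactly in the (possibly empty) face spanned by their common vertices. -/
structure TetMesh where
  air : Finset (Finset E3)
  conductor : Finset (Finset E3)
  disjoint : Disjoint air conductor
  card_eq : ∀ K ∈ air ∪ conductor, K.card = 4
  affineIndependent : ∀ K ∈ air ∪ conductor, AffineIndependent ℝ ((↑) : K → E3)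
  conforming : ∀ K ∈ air ∪ conductor, ∀ L ∈ air ∪ conductor,
    convexHull ℝ (K : Set E3) ∩ convexHull ℝ (L : Set E3) ⊆ convexHull ℝ (↑(K ∩ L) : Set E3)

/-- All tetrahedra of the mesh. -/
def TetMesh.elements (M : TetMesh) : Finset (Finset E3) := M.air ∪ M.conductor

/-- The union of the closed tetrahedra in `S`. -/
def cells (S : Finset (Finset E3)) : Set E3 := ⋃ K ∈ S, convexHull ℝ (K : Set E3)

/-- The computational domain `Ω`. -/
def TetMesh.Ω (M : TetMesh) : Set E3 := interior (cells M.elements)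

/-- The non-conducting subdomain `Ω₀`. -/
def TetMesh.Ω₀ (M : TetMesh) : Set E3 := interior (cells M.air)

/-- The conducting subdomain `Ω_c`, the complement in `Ω` of the closure of `Ω₀`. -/
def TetMesh.Ωc (M : TetMesh) : Set E3 := M.Ω \ closure M.Ω₀

/-- `n` is an outward unit normal at the boundary point `x` of the convex domain `D`. -/
def IsOutwardUnitNormal (D : Set E3) (x n : E3) : Prop :=
  ‖n‖ = 1 ∧ ∀ y ∈ D, inner ℝ n (y - x) ≤ 0

/-- The surface measure on the part `Γ` of the boundary (two-dimensional Hausdorff measure,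
normalised to be area on planes). -/
def surface (Γ : Set E3) : Measure E3 :=
  (Measure.euclideanHausdorffMeasure 2 : Measure E3).restrict Γ

/-! ### Function spaces -/

/-- The space `H_Γ(curl; D)`: square integrable fields `u` on `D` with square integrable weak curl
`v` and `n × u = 0` on `∂D \ closure Γ`. The boundary condition is the weak one: Green's formula
has no boundary term for test fields that are supported away from `closure Γ`. Test fields with
compact support in `D` are among these, so `v` is the distributional curl of `u`. -/
def MemHcurl (D Γ : Set E3) (u : E3 → C3) : Prop :=
  MemLp u 2 (volume.restrict D) ∧
  ∃ v : E3 → C3, MemLp v 2 (volume.restrict D) ∧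
    ∀ w : E3 → C3, ContDiff ℝ (⊤ : ℕ∞) w → HasCompactSupport w → Disjoint (tsupport w) (closure Γ) →
      ∫ x in D, u x ⬝ᵥ curl w x = ∫ x in D, v x ⬝ᵥ w x

/-- The (complex) lowest order Nédélec edge element space `X_h`: the members of `H_Γ(curl; Ω)`
that have the form `a_K + b_K × x` on every tetrahedron `K`. The pointwise representative is fixed
so that a point of exactly one closed tetrahedron `K` (almost every point of `Ω` and, for the
surface measure, almost every point of `∂Ω`) has the value `a_K + b_K × x`; on `∂Ω` it is
therefore the trace from the inside. -/
def edgeSpace (M : TetMesh) (Γ : Set E3) : Set (E3 → C3) :=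
  {u | MemHcurl M.Ω Γ u ∧ ∃ a b : Finset E3 → C3, ∀ x, u x =
    ∑ K ∈ M.elements, (convexHull ℝ (K : Set E3)).indicator (fun y => a K + b K ⨯₃ toC3 y) x}

/-- The (complex) space `U_h ⊂ H¹_Γ(Ω₀)` of continuous piecewise linear functions on the mesh
of `Ω₀` that vanish on `∂Ω₀ \ Γ`. Values outside the closure of `Ω₀` are irrelevant. -/
def multiplierSpace (M : TetMesh) (Γ : Set E3) : Set (E3 → ℂ) :=
  {φ | ContinuousOn φ (cells M.air) ∧
    (∀ K ∈ M.air, ∃ (a : C3) (c : ℂ), ∀ x ∈ convexHull ℝ (K : Set E3), φ x = a ⬝ᵥ toC3 x + c) ∧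
    ∀ x ∈ frontier M.Ω₀ \ Γ, φ x = 0}

/-- The (real) space `V_h ⊂ H¹₀(Ω_c)` of continuous piecewise linear functions on the mesh of
`Ω_c` that vanish on `∂Ω_c`, extended by zero. -/
def conductivitySpace (M : TetMesh) : Set (E3 → ℝ) :=
  {σ | Continuous σ ∧ (∀ x ∉ M.Ωc, σ x = 0) ∧
    ∀ K ∈ M.conductor, ∃ (a : E3) (c : ℝ), ∀ x ∈ convexHull ℝ (K : Set E3),
      σ x = inner ℝ a x + c}

/-! ### The state problem and the objective -/

/-- The data of the eddy current model. -/
structure Coefficients where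
  /-- magnetic permeability -/
  μ : E3 → ℝ
  /-- electric permittivity -/
  ε : E3 → ℝ
  /-- angular frequency -/
  ω : ℝ
  /-- background conductivity in the conducting subdomain -/
  σ₀ : ℝ
  /-- source current -/
  J : E3 → C3

/-- Standing assumptions on the data: `μ` (on `Ω`) and `ε` (on `Ω₀`) are measurable and bounded
above and below by positive constants, `ω` and `σ₀` are positive, and `J` is a square integrable
divergence free field with compact support in `Ω₀`. -/
structure Coefficients.Admissible (P : Coefficients) (M : TetMesh) : Prop where
  μ_meas : Measurable P.μ
  μ_bounds : ∃ m > 0, ∃ m' : ℝ, ∀ x ∈ M.Ω, m ≤ P.μ x ∧ P.μ x ≤ m'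
  ε_meas : Measurable P.ε
  ε_bounds : ∃ m > 0, ∃ m' : ℝ, ∀ x ∈ M.Ω₀, m ≤ P.ε x ∧ P.ε x ≤ m'
  ω_pos : 0 < P.ω
  σ₀_pos : 0 < P.σ₀
  J_memLp : MemLp P.J 2 volume
  J_compact : HasCompactSupport P.J
  J_support : tsupport P.J ⊆ M.Ω₀
  J_div : ∀ ψ : E3 → ℂ, ContDiff ℝ (⊤ : ℕ∞) ψ → HasCompactSupport ψ → tsupport ψ ⊆ M.Ω →
    ∫ x in M.Ω, P.J x ⬝ᵥ grad ψ x = 0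

/-- The form `a_h(E, F)` for the abnormal conductivity `σ`. The total conductivity is `σ₀ + σ` in
`Ω_c` and zero in `Ω₀`. For edge element fields, which are affine on each tetrahedron, `curl` is
the weak curl almost everywhere. -/
def formA (M : TetMesh) (P : Coefficients) (σ : E3 → ℝ) (E F : E3 → C3) : ℂ :=
  (∫ x in M.Ω, (((P.μ x)⁻¹ : ℝ) : ℂ) * (curl E x ⬝ᵥ star (curl F x)))
    - Complex.I * (P.ω : ℂ) *
      ∫ x in M.Ωc, ((P.σ₀ + σ x : ℝ) : ℂ) * (E x ⬝ᵥ star (F x))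

/-- The form `b(E, F)`. -/
def formB (M : TetMesh) (P : Coefficients) (E F : E3 → C3) : ℂ :=
  ∫ x in M.Ω₀, ((P.ε x : ℝ) : ℂ) * (E x ⬝ᵥ star (F x))

/-- `(E, φ)` solves the discrete saddle point state problem for the abnormal conductivity `σ`. -/
structure IsDiscreteState (M : TetMesh) (Γ : Set E3) (P : Coefficients) (σ : E3 → ℝ)
    (E : E3 → C3) (φ : E3 → ℂ) : Prop where
  E_mem : E ∈ edgeSpace M Γ
  φ_mem : φ ∈ multiplierSpace M Γ
  state : ∀ F ∈ edgeSpace M Γ,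
    formA M P σ E F + formB M P (grad φ) F
      = Complex.I * (P.ω : ℂ) * ∫ x in M.Ω, P.J x ⬝ᵥ star (F x)
  constraint : ∀ ψ ∈ multiplierSpace M Γ, formB M P E (grad ψ) = 0

/-- Squared Euclidean length of a complex vector. -/
def normSq3 (v : C3) : ℝ := ∑ i, ‖v i‖ ^ 2

/-- The regularised misfit
`½ ‖n × (E - Eobs)‖²_{L²(Γ)} + (α/2) ‖∇σ‖²_{L²(Ω_c)}`. -/
def objective (M : TetMesh) (Γ : Set E3) (n : E3 → E3) (Eobs : E3 → C3) (α : ℝ)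
    (σ : E3 → ℝ) (E : E3 → C3) : ℝ :=
  (1 / 2) * (∫ x, normSq3 (toC3 (n x) ⨯₃ (E x - Eobs x)) ∂(surface Γ))
    + (α / 2) * ∫ x in M.Ωc, ‖gradient σ x‖ ^ 2

/-- The admissible discrete abnormal conductivities: members of `V_h` whose total conductivity
`σ₀ + σ` is at least `σmin` in `Ω_c`. -/
def admissibleSet (M : TetMesh) (P : Coefficients) (σmin : ℝ) : Set (E3 → ℝ) :=
  {σ | σ ∈ conductivitySpace M ∧ ∀ x ∈ M.Ωc, σmin ≤ P.σ₀ + σ x}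

end EddyCurrent

end

/-!
All fields of the discrete problem are determined by finitely many coefficients: an edge element
field by the pairs `(a_K, b_K)` (`field`, `edgeCoef`), its curl by `2 b_K` (`curlCoef`), and the
gradient of a multiplier by one vector for each element. Outside a null set every point lies in
exactly one open element (`TetMesh.core`), so that all integrals are forms on these coefficients.

*Existence of a state.* The multiplier enters only through the functionals `b(∇φ, ·)`, which form a
subspace of a finite dimensional dual space. Passing to the annihilator of that subspace and back
(`exists_constrained_space`), the state problem becomes one equation `(A - iωS)E = f` on a finite
dimensional Hilbert space `H`, where `A` represents the curl-curl form and `S` the form of the total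
conductivity; both are positive, and there is no inf-sup condition to verify. The equation is
solvable if `f` is orthogonal to the kernel of `A` (`exists_state`). If `A F = 0`, then `F` is curl
free on every element and, being in `H(curl)`, weakly curl free in `Ω`. A divergence free source
with compact support in the convex domain `Ω` is orthogonal to such a field: mollify `F`, apply the
Poincaré lemma on a slightly smaller convex set, cut off the potential, and remove the mollification
(`integral_source_field_eq_zero`). Hence the source is orthogonal to `ker A`.

*Existence of a minimizer.* The gradient is injective on the conductivities
(`eq_zero_of_gradient_ae_eq_zero`), so the conductivities `σ_k` of a minimizing sequence have a
convergent subsequence. The states `E_k`, however, are not unique where the total conductivity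
vanishes, and a minimizing sequence of states may be unbounded. Only `A E_k`, the traces `T E_k`,
and `S E_k` for the limiting conductivity form `S` are bounded. The last bound is due to the energy
identity together with `S_k ≥ c S` for large `k`, for any `c < 1`; this inequality has only to be
checked at the vertices (`eventually_isPositive_sub`). One may therefore write
`E_k = p_k + w_k` with `p_k` bounded and `A w_k = 0`, `T w_k = 0`, `S w_k = 0`. The Cauchy-Schwarz
inequality for `S_k - c S`, with `c` close to one, shows that `S_k w_k → 0`. So a limit of the `p_k`
is a state for the limit of the `σ_k`, and its trace is the limit of the traces
(`exists_limit_state`, `exists_minimizer`).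

The traces are square integrable because `∂Ω` lies in finitely many triangles and has finite area
(`isFiniteMeasure_surface`).
-/

noncomputable section

open Filter Topology
open scoped InnerProductSpace ComplexOrder Convolution

namespace EddyCurrent

/-! ### Positive operators and the reduced problem -/

section Abstract

variable {H : Type*} [NormedAddCommGroup H] [InnerProductSpace ℂ H]

theorem IsPositive.im_inner {T : H →L[ℂ] H} (hT : T.IsPositive) (x : H) :
    (⟪x, T x⟫_ℂ).im = 0 :=
  ((Complex.nonneg_iff.mp (hT.inner_nonneg_right x)).2).symm

theorem IsPositive.re_inner {T : H →L[ℂ] H} (hT : T.IsPositive) (x : H) :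
    0 ≤ (⟪x, T x⟫_ℂ).re :=
  (Complex.nonneg_iff.mp (hT.inner_nonneg_right x)).1

/-- Real and imaginary part of the equation tested with its solution. -/
theorem energy_bound {A S : H →L[ℂ] H} (hA : A.IsPositive) (hS : S.IsPositive) {ω : ℝ}
    (hω : 0 < ω) {f E : H} (h : A E - (Complex.I * ω) • S E = f) :
    (⟪E, A E⟫_ℂ).re ≤ ‖⟪E, f⟫_ℂ‖ ∧ (⟪E, S E⟫_ℂ).re ≤ ω⁻¹ * ‖⟪E, f⟫_ℂ‖ := by
  have h1 : ⟪E, f⟫_ℂ = ⟪E, A E⟫_ℂ - (Complex.I * ω) * ⟪E, S E⟫_ℂ := by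
    rw [← h, inner_sub_right, inner_smul_right]
  have hre := congrArg Complex.re h1
  have him := congrArg Complex.im h1
  simp [IsPositive.im_inner hS, IsPositive.im_inner hA] at hre him
  constructor
  · rw [← hre]; exact Complex.re_le_norm _
  · have := (neg_le_abs _).trans (Complex.abs_im_le_norm ⟪E, f⟫_ℂ)
    rw [him, neg_neg] at this
    rw [inv_mul_eq_div, le_div_iff₀ hω]; linarith

variable [FiniteDimensional ℂ H]

/-- A linear map on a finite dimensional space can be inverted on its range with a linear bound:
modulo the kernel, `E` is controlled by `Q E`. -/
theorem _root_.LinearMap.exists_bounded_preimage {Y : Type*} [NormedAddCommGroup Y]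
    [NormedSpace ℂ Y] (Q : H →ₗ[ℂ] Y) :
    ∃ C, 0 ≤ C ∧ ∀ E, ∃ E', Q E' = Q E ∧ ‖E'‖ ≤ C * ‖Q E‖ := by
  obtain ⟨g, hg⟩ := Q.rangeRestrict.exists_rightInverse_of_surjective Q.range_rangeRestrict
  refine ⟨‖g.toContinuousLinearMap‖, norm_nonneg g.toContinuousLinearMap, fun E =>
    ⟨g (Q.rangeRestrict E), ?_, ?_⟩⟩
  · have := congrArg Subtype.val (LinearMap.congr_fun hg (Q.rangeRestrict E))
    simpa using this
  · have := g.toContinuousLinearMap.le_opNorm (Q.rangeRestrict E)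
    simpa using this

/-- A positive operator is `R* R`; here `R` carries the energy `⟪x, T x⟫ = ‖R x‖²`. -/
theorem IsPositive.exists_factor {T : H →L[ℂ] H} (hT : T.IsPositive) :
    ∃ R : H →L[ℂ] H, ‖R‖ ^ 2 = ‖T‖ ∧ (∀ x, ‖R x‖ ^ 2 = (⟪x, T x⟫_ℂ).re) ∧
      ∀ x, ‖T x‖ ≤ ‖R‖ * ‖R x‖ := by
  have : CompleteSpace H := FiniteDimensional.complete ℂ H
  obtain ⟨R, hR⟩ := CStarAlgebra.nonneg_iff_eq_star_mul_self.mp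
    ((ContinuousLinearMap.nonneg_iff_isPositive T).mpr hT)
  have hx : ∀ x, T x = ContinuousLinearMap.adjoint R (R x) := fun x => by rw [hR]; rfl
  refine ⟨R, ?_, fun x => ?_, fun x => ?_⟩
  · rw [hR, CStarRing.norm_star_mul_self, sq]
  · rw [hx, ContinuousLinearMap.adjoint_inner_right, ← inner_self_eq_norm_sq (𝕜 := ℂ)]; rfl
  · rw [hx]
    refine (ContinuousLinearMap.le_opNorm _ _).trans_eq ?_
    rw [LinearIsometryEquiv.norm_map]

/-- The Cauchy-Schwarz inequality for the form of a positive operator. -/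
theorem IsPositive.norm_apply_sq_le {T : H →L[ℂ] H} (hT : T.IsPositive) (x : H) :
    ‖T x‖ ^ 2 ≤ ‖T‖ * (⟪x, T x⟫_ℂ).re := by
  obtain ⟨R, h1, h2, h3⟩ := IsPositive.exists_factor hT
  rw [← h1, ← h2, ← mul_pow]
  exact pow_le_pow_left₀ (norm_nonneg _) (h3 x) 2

/-- The kernel of the adjoint `A + i ω S` lies in the kernel of `A`, because the real part of its
form is that of `A`; hence a load that is orthogonal to `ker A` is in the range. -/
theorem exists_state {A S : H →L[ℂ] H} (hA : A.IsPositive) (hS : S.IsPositive) (ω : ℝ) {f : H}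
    (hf : ∀ F, A F = 0 → ⟪F, f⟫_ℂ = 0) :
    ∃ E, A E - (Complex.I * ω) • S E = f := by
  have : CompleteSpace H := FiniteDimensional.complete ℂ H
  set B : H →L[ℂ] H := A - (Complex.I * ω) • S with hB
  have hBadj : ∀ F, ContinuousLinearMap.adjoint B F = A F + (Complex.I * ω) • S F := by
    intro F
    simp [hB, hA.isSelfAdjoint.adjoint_eq, hS.isSelfAdjoint.adjoint_eq, map_sub, map_smulₛₗ]
  have hmem : f ∈ (LinearMap.range (B : H →ₗ[ℂ] H)) := by
    rw [← Submodule.orthogonal_orthogonal (LinearMap.range (B : H →ₗ[ℂ] H))]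
    intro F hF
    apply hf
    have h0 : ContinuousLinearMap.adjoint B F = 0 := by
      apply ext_inner_left ℂ
      intro v
      rw [ContinuousLinearMap.adjoint_inner_right, inner_zero_right]
      exact hF _ ⟨v, rfl⟩
    have h1 : ⟪F, ContinuousLinearMap.adjoint B F⟫_ℂ = 0 := by rw [h0, inner_zero_right]
    rw [hBadj, inner_add_right, inner_smul_right] at h1
    have h2 := congrArg Complex.re h1
    simp [IsPositive.im_inner hS] at h2
    have := IsPositive.norm_apply_sq_le hA F
    rw [h2, mul_zero] at this
    exact norm_eq_zero.mp (pow_eq_zero_iff two_ne_zero |>.mp (le_antisymm this (sq_nonneg _)))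
  obtain ⟨E, hE⟩ := hmem
  exact ⟨E, hE⟩

/-- States for a converging sequence of conductivity forms `Sk` whose observations `T (Ek k)` stay
bounded have a limit state whose observation is a limit of theirs, even though the states `Ek`
themselves may be unbounded. Convergence of `Sk` alone would not do: `hlow` says that `Sk` does not
lose any of the limiting form, and is what makes the unbounded part of `Ek` negligible. -/
theorem exists_limit_state {Y : Type*} [NormedAddCommGroup Y] [NormedSpace ℂ Y]
    {A S : H →L[ℂ] H} (hA : A.IsPositive) (hS : S.IsPositive) {ω : ℝ} (hω : 0 < ω) {f : H}
    (hf : ∀ F, A F = 0 → ⟪F, f⟫_ℂ = 0) (T : H →ₗ[ℂ] Y)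
    {Sk : ℕ → H →L[ℂ] H} (hSk : ∀ k, (Sk k).IsPositive) (hlim : Tendsto Sk atTop (𝓝 S))
    (hlow : ∀ c : ℝ, c < 1 → ∀ᶠ k in atTop, (Sk k - (c : ℂ) • S).IsPositive)
    {Ek : ℕ → H} (hE : ∀ k, A (Ek k) - (Complex.I * ω) • Sk k (Ek k) = f)
    {t : ℝ} (hT : ∀ k, ‖T (Ek k)‖ ≤ t) :
    ∃ E, A E - (Complex.I * ω) • S E = f ∧ ∃ ns : ℕ → ℕ, StrictMono ns ∧
      Tendsto (fun k => T (Ek (ns k))) atTop (𝓝 (T E)) := by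
  have : CompleteSpace H := FiniteDimensional.complete ℂ H
  have : ProperSpace H := FiniteDimensional.proper ℂ H
  -- the part of a state that the energy and the observation control; `p` forgets the rest
  set Q : H →ₗ[ℂ] H × Y × H := (A : H →ₗ[ℂ] H).prod (T.prod (S : H →ₗ[ℂ] H)) with hQ
  have hQE : ∀ E, Q E = (A E, T E, S E) := fun E => rfl
  obtain ⟨C, hC0, hC⟩ := Q.exists_bounded_preimage
  choose p hp1 hp2 using hC
  have hpA : ∀ E, A (p E) = A E := fun E => congrArg Prod.fst (hp1 E)
  have hpT : ∀ E, T (p E) = T E := fun E => congrArg (fun z => z.2.1) (hp1 E)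
  have hpS : ∀ E, S (p E) = S E := fun E => congrArg (fun z => z.2.2) (hp1 E)
  -- the load is controlled by `Q`, since it vanishes on `ker Q ⊆ ker A`
  have hload : ∀ E, ‖⟪E, f⟫_ℂ‖ ≤ C * ‖f‖ * ‖Q E‖ := by
    intro E
    have h1 : ⟪E - p E, f⟫_ℂ = 0 := hf _ (by rw [map_sub, hpA, sub_self])
    rw [inner_sub_left, sub_eq_zero] at h1
    rw [h1]
    calc _ ≤ ‖p E‖ * ‖f‖ := norm_inner_le_norm _ _
      _ ≤ (C * ‖Q E‖) * ‖f‖ := by gcongr; exact hp2 E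
      _ = _ := by ring
  have ht0 : 0 ≤ t := (norm_nonneg _).trans (hT 0)
  set D : ℝ := ‖A‖ * (C * ‖f‖) + 2 * ‖S‖ * ω⁻¹ * (C * ‖f‖) with hD
  have hD0 : 0 ≤ D := by positivity
  have hbd : ∀ᶠ k in atTop, ‖Q (Ek k)‖ ≤ D + t := by
    filter_upwards [hlow (1 / 2) (by norm_num)] with k hk
    obtain ⟨e1, e2⟩ := energy_bound hA (hSk k) hω (hE k)
    have hl := hload (Ek k)
    set x := ‖Q (Ek k)‖ with hx
    have hx0 : 0 ≤ x := norm_nonneg _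
    have hS2 : (⟪Ek k, S (Ek k)⟫_ℂ).re ≤ 2 * (⟪Ek k, Sk k (Ek k)⟫_ℂ).re := by
      have := IsPositive.re_inner hk (Ek k)
      simp at this
      linarith
    have hA2 : ‖A (Ek k)‖ ^ 2 ≤ D * x := by
      calc _ ≤ ‖A‖ * (⟪Ek k, A (Ek k)⟫_ℂ).re := IsPositive.norm_apply_sq_le hA _
        _ ≤ ‖A‖ * (C * ‖f‖ * x) := by gcongr; exact e1.trans hl
        _ ≤ D * x := by
          rw [hD, ← mul_assoc]; gcongr
          exact le_add_of_nonneg_right (by positivity)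
    have hS3 : ‖S (Ek k)‖ ^ 2 ≤ D * x := by
      calc _ ≤ ‖S‖ * (⟪Ek k, S (Ek k)⟫_ℂ).re := IsPositive.norm_apply_sq_le hS _
        _ ≤ ‖S‖ * (2 * (ω⁻¹ * (C * ‖f‖ * x))) := by
            gcongr
            refine hS2.trans ?_
            gcongr
            refine e2.trans ?_
            gcongr
        _ ≤ D * x := by
          rw [hD, add_mul]
          have : 0 ≤ ‖A‖ * (C * ‖f‖) * x := by positivity
          linarith
    have hT2 : ‖T (Ek k)‖ ^ 2 ≤ t ^ 2 := pow_le_pow_left₀ (norm_nonneg _) (hT k) 2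
    have hx2 : x ^ 2 ≤ D * x + t ^ 2 := by
      have hDx : 0 ≤ D * x := by positivity
      have ht2 : 0 ≤ t ^ 2 := sq_nonneg t
      have hx' : x = max ‖A (Ek k)‖ (max ‖T (Ek k)‖ ‖S (Ek k)‖) := rfl
      rcases max_choice ‖A (Ek k)‖ (max ‖T (Ek k)‖ ‖S (Ek k)‖) with h | h
      · rw [h] at hx'
        nth_rewrite 1 [hx']; linarith
      · rw [h] at hx'
        rcases max_choice ‖T (Ek k)‖ ‖S (Ek k)‖ with h' | h' <;> rw [h'] at hx' <;>
          nth_rewrite 1 [hx'] <;> linarith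
    -- `x ^ 2 ≤ D * x + t ^ 2` fails for `x > D + t`
    by_contra hcon
    push Not at hcon
    nlinarith
  -- replace `Ek` by bounded representatives
  obtain ⟨E, -, ns, hns, hconv⟩ : ∃ E ∈ Metric.closedBall (0 : H) (C * (D + t)),
      ∃ ns : ℕ → ℕ, StrictMono ns ∧ Tendsto ((fun k => p (Ek k)) ∘ ns) atTop (𝓝 E) := by
    refine (isCompact_closedBall _ _).tendsto_subseq' ?_
    apply Eventually.frequently
    filter_upwards [hbd] with k hk
    rw [mem_closedBall_zero_iff]
    exact (hp2 _).trans (by gcongr)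
  refine ⟨E, ?_, ns, hns, ?_⟩
  swap
  · have hc : Continuous T := T.continuous_of_finiteDimensional
    have := (hc.tendsto E).comp hconv
    refine this.congr fun k => ?_
    simp [hpT]
  -- the discarded part does not contribute in the limit
  have hSp : Tendsto (fun k => Sk (ns k) (p (Ek (ns k)))) atTop (𝓝 (S E)) := by
    have h2 := (hlim.comp hns.tendsto_atTop)
    exact (isBoundedBilinearMap_apply.continuous.tendsto (S, E)).comp (h2.prodMk_nhds hconv)
  set b : ℝ := ω⁻¹ * (C * ‖f‖ * (D + t)) with hb
  have hb0 : 0 ≤ b := by positivity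
  have hcross : Tendsto (fun k => Sk (ns k) (Ek (ns k) - p (Ek (ns k)))) atTop (𝓝 0) := by
    -- energy of the discarded part
    have hpbd : ∃ b', 0 ≤ b' ∧ ∀ᶠ k in atTop,
        (⟪Ek k - p (Ek k), Sk k (Ek k - p (Ek k))⟫_ℂ).re ≤ b' := by
      have hSn : ∀ᶠ k in atTop, ‖Sk k‖ ≤ ‖S‖ + 1 :=
        (hlim.norm).eventually (ge_mem_nhds (by linarith))
      refine ⟨2 * b + 2 * ((‖S‖ + 1) * (C * (D + t)) ^ 2), by positivity, ?_⟩
      filter_upwards [hbd, hSn] with k hk hn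
      obtain ⟨-, e2⟩ := energy_bound hA (hSk k) hω (hE k)
      have e3 : (⟪Ek k, Sk k (Ek k)⟫_ℂ).re ≤ b := by
        refine e2.trans ?_
        rw [hb]; gcongr
        exact (hload _).trans (by gcongr)
      obtain ⟨R, r1, r2, -⟩ := IsPositive.exists_factor (hSk k)
      rw [← r2, map_sub]
      rw [← r2] at e3
      have e4 : ‖R (p (Ek k))‖ ^ 2 ≤ (‖S‖ + 1) * (C * (D + t)) ^ 2 := by
        calc _ ≤ (‖R‖ * ‖p (Ek k)‖) ^ 2 := by gcongr; exact R.le_opNorm _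
          _ = ‖Sk k‖ * ‖p (Ek k)‖ ^ 2 := by rw [mul_pow, r1]
          _ ≤ _ := by gcongr; exact (hp2 _).trans (by gcongr)
      have e5 := norm_sub_le (R (Ek k)) (R (p (Ek k)))
      have e6 : ‖R (Ek k) - R (p (Ek k))‖ ^ 2 ≤ (‖R (Ek k)‖ + ‖R (p (Ek k))‖) ^ 2 := by gcongr
      nlinarith [sq_nonneg (‖R (Ek k)‖ - ‖R (p (Ek k))‖)]
    obtain ⟨b', hb'0, hb'⟩ := hpbd
    suffices Tendsto (fun k => Sk k (Ek k - p (Ek k))) atTop (𝓝 0) from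
      this.comp hns.tendsto_atTop
    rw [Metric.tendsto_atTop']
    intro ε hε
    -- `w` is in the kernel of `S`, so `Sk w = (Sk - c S) w` for `c = 1 - δ`, and the norm of
    -- `Sk - c S` is small together with `δ`
    obtain ⟨δ, hδ0, hδ⟩ : ∃ δ : ℝ, 0 < δ ∧ (δ + δ * ‖S‖) * b' < ε ^ 2 := by
      have h1 : Tendsto (fun δ : ℝ => (δ + δ * ‖S‖) * b') (𝓝 0) (𝓝 0) := by
        have : Continuous (fun δ : ℝ => (δ + δ * ‖S‖) * b') := by fun_prop
        simpa using this.tendsto 0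
      have h2 := (h1.eventually (gt_mem_nhds (by positivity : (0:ℝ) < ε ^ 2)))
      have h3 : ∀ᶠ δ in 𝓝[>] (0:ℝ), (δ + δ * ‖S‖) * b' < ε ^ 2 := h2.filter_mono nhdsWithin_le_nhds
      obtain ⟨δ, h5, h6⟩ := (h3.and self_mem_nhdsWithin).exists
      exact ⟨δ, h6, h5⟩
    have hclose : ∀ᶠ k in atTop, ‖Sk k - S‖ < δ := by
      have := (tendsto_iff_norm_sub_tendsto_zero.mp hlim)
      exact this.eventually (gt_mem_nhds hδ0)
    have hall := ((hb'.and hclose).and (hlow (1 - δ) (by linarith)))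
    obtain ⟨N, hN⟩ := eventually_atTop.mp hall
    refine ⟨N, fun k hk => ?_⟩
    obtain ⟨⟨k1, k2⟩, k3⟩ := hN k hk.le
    rw [dist_zero_right]
    set w := Ek k - p (Ek k) with hw
    have hSw : S w = 0 := by rw [hw, map_sub, hpS, sub_self]
    have hTw : (Sk k - ((1 - δ : ℝ) : ℂ) • S) w = Sk k w := by simp [hSw]
    have hn : ‖Sk k - ((1 - δ : ℝ) : ℂ) • S‖ ≤ δ + δ * ‖S‖ := by
      have : Sk k - ((1 - δ : ℝ) : ℂ) • S = (Sk k - S) + (δ : ℂ) • S := by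
        push_cast; module
      rw [this]
      refine (norm_add_le _ _).trans ?_
      rw [norm_smul]
      simp only [Complex.norm_real, Real.norm_eq_abs, abs_of_pos hδ0]
      gcongr
    have h7 := IsPositive.norm_apply_sq_le k3 w
    rw [hTw] at h7
    have h8 : ‖Sk k w‖ ^ 2 < ε ^ 2 := by
      refine (h7.trans ?_).trans_lt hδ
      have := IsPositive.re_inner (hSk k) w
      gcongr
    exact lt_of_pow_lt_pow_left₀ 2 hε.le h8
  have hAp : Tendsto (fun k => A (p (Ek (ns k)))) atTop (𝓝 (A E)) :=
    (A.continuous.tendsto E).comp hconv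
  have hsum := (hAp.sub (hSp.const_smul (Complex.I * (ω : ℂ)))).sub
    (hcross.const_smul (Complex.I * (ω : ℂ)))
  have hconst : Tendsto (fun _ : ℕ => f) atTop
      (𝓝 (A E - (Complex.I * ω) • S E - (Complex.I * ω) • (0 : H))) := by
    refine hsum.congr fun k => ?_
    rw [hpA, map_sub, smul_sub]
    rw [← hE (ns k)]; abel
  have := tendsto_nhds_unique hconst tendsto_const_nhds
  simpa using this

/-- The direct method for the reduced problem. Coercivity in the control comes from the injectivity
of `G`; in the state it is replaced by `exists_limit_state`. -/
theorem exists_minimizer {V Y Z : Type*} [NormedAddCommGroup V] [NormedSpace ℝ V]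
    [FiniteDimensional ℝ V] [NormedAddCommGroup Y] [NormedSpace ℂ Y] [NormedAddCommGroup Z]
    [NormedSpace ℝ Z] {A : H →L[ℂ] H} (hA : A.IsPositive) {S : V → H →L[ℂ] H}
    (hScont : Continuous S)
    {K : Set V} (hK : IsClosed K) (hKne : K.Nonempty) (hS : ∀ σ ∈ K, (S σ).IsPositive)
    (hlow : ∀ σ ∈ K, ∀ c : ℝ, c < 1 → ∀ᶠ τ in 𝓝[K] σ, (S τ - (c : ℂ) • S σ).IsPositive)
    {ω : ℝ} (hω : 0 < ω) {f : H} (hf : ∀ F, A F = 0 → ⟪F, f⟫_ℂ = 0)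
    (T : H →ₗ[ℂ] Y) (d : Y) (G : V →ₗ[ℝ] Z) (hG : Function.Injective G) {α : ℝ} (hα : 0 < α) :
    ∃ σ ∈ K, ∃ E, A E - (Complex.I * ω) • S σ E = f ∧
      ∀ σ' ∈ K, ∀ E', A E' - (Complex.I * ω) • S σ' E' = f →
        1 / 2 * ‖T E - d‖ ^ 2 + α / 2 * ‖G σ‖ ^ 2 ≤
          1 / 2 * ‖T E' - d‖ ^ 2 + α / 2 * ‖G σ'‖ ^ 2 := by
  have : ProperSpace V := FiniteDimensional.proper ℝ V
  set Φ : V × H → ℝ := fun z => 1 / 2 * ‖T z.2 - d‖ ^ 2 + α / 2 * ‖G z.1‖ ^ 2 with hΦ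
  set F : Set (V × H) := {z | z.1 ∈ K ∧ A z.2 - (Complex.I * ω) • S z.1 z.2 = f} with hF
  have hFne : F.Nonempty := by
    obtain ⟨σ, hσ⟩ := hKne
    obtain ⟨E, hE⟩ := exists_state hA (hS σ hσ) ω hf
    exact ⟨(σ, E), hσ, hE⟩
  have hΦ0 : ∀ z, 0 ≤ Φ z := fun z => by positivity
  have hbdd : BddBelow (Φ '' F) := ⟨0, by rintro _ ⟨z, -, rfl⟩; exact hΦ0 z⟩
  obtain ⟨u, -, hu, huF⟩ := exists_seq_tendsto_sInf (hFne.image Φ) hbdd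
  choose z hzF hzu using huF
  obtain ⟨m, hm⟩ := hu.bddAbove_range
  have hm' : ∀ k, Φ (z k) ≤ m := fun k => hzu k ▸ hm ⟨k, rfl⟩
  have hm0 : 0 ≤ m := (hΦ0 _).trans (hm' 0)
  obtain ⟨c, -, hc⟩ := G.injective_iff_antilipschitz.mp hG
  have hσbd : ∀ k, (z k).1 ∈ Metric.closedBall (0 : V) (c * Real.sqrt (2 * m / α)) := by
    intro k
    rw [mem_closedBall_zero_iff]
    have h0 := hc.le_mul_dist (z k).1 0
    rw [map_zero, dist_zero_right, dist_zero_right] at h0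
    refine h0.trans ?_
    gcongr
    apply Real.le_sqrt_of_sq_le
    rw [le_div_iff₀ hα]
    have := hm' k
    simp only [hΦ] at this
    nlinarith [sq_nonneg ‖T (z k).2 - d‖]
  obtain ⟨σ, -, ns, hns, hσ⟩ := (isCompact_closedBall _ _).tendsto_subseq hσbd
  have hσK : σ ∈ K := hK.mem_of_tendsto hσ (Eventually.of_forall fun k => (hzF (ns k)).1)
  have hσ' : Tendsto (fun k => (z (ns k)).1) atTop (𝓝[K] σ) :=
    tendsto_nhdsWithin_iff.mpr ⟨hσ, Eventually.of_forall fun k => (hzF (ns k)).1⟩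
  have hTbd : ∀ k, ‖T (z (ns k)).2‖ ≤ Real.sqrt (2 * m) + ‖d‖ := by
    intro k
    have h1 : ‖T (z (ns k)).2 - d‖ ≤ Real.sqrt (2 * m) := by
      apply Real.le_sqrt_of_sq_le
      have := hm' (ns k)
      simp only [hΦ] at this
      have h2 : 0 ≤ α / 2 * ‖G (z (ns k)).1‖ ^ 2 := by positivity
      linarith
    have := norm_le_norm_sub_add (T (z (ns k)).2) d
    linarith
  obtain ⟨E, hE, ms, hms, hTE⟩ := exists_limit_state hA (hS σ hσK) hω hf T
    (fun k => hS _ (hzF (ns k)).1) ((hScont.tendsto σ).comp hσ)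
    (fun c hc => hσ'.eventually (hlow σ hσK c hc)) (fun k => (hzF (ns k)).2) hTbd
  refine ⟨σ, hσK, E, hE, fun σ' hσ'K E' hE' => ?_⟩
  have hGc : Continuous G := G.continuous_of_finiteDimensional
  have h1 : Tendsto (fun k => Φ (z (ns (ms k)))) atTop
      (𝓝 (1 / 2 * ‖T E - d‖ ^ 2 + α / 2 * ‖G σ‖ ^ 2)) := by
    have hg := ((hGc.tendsto σ).comp (hσ.comp hms.tendsto_atTop)).norm.pow 2
    have ht := (hTE.sub_const d).norm.pow 2
    exact (ht.const_mul _).add (hg.const_mul _)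
  have h2 : Tendsto (fun k => Φ (z (ns (ms k)))) atTop (𝓝 (sInf (Φ '' F))) := by
    refine (hu.comp (hns.comp hms).tendsto_atTop).congr fun k => ?_
    exact (hzu _).symm
  rw [tendsto_nhds_unique h1 h2]
  exact csInf_le hbdd ⟨(σ', E'), ⟨hσ'K, hE'⟩, rfl⟩

end Abstract

section MeshGeometry

/-! ### Geometry of the mesh -/

/-- The part of the open tetrahedron `K` that lies on no other element. -/
def TetMesh.core (M : TetMesh) (K : Finset E3) : Set E3 :=
  interior (convexHull ℝ (K : Set E3)) \ ⋃ L ∈ M.elements.erase K, convexHull ℝ (L : Set E3)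

theorem isCompact_hull (K : Finset E3) : IsCompact (convexHull ℝ (K : Set E3)) :=
  K.finite_toSet.isCompact_convexHull ℝ

theorem isCompact_cells (S : Finset (Finset E3)) : IsCompact (cells S) :=
  S.isCompact_biUnion fun K _ => isCompact_hull K

theorem subset_cells {S : Finset (Finset E3)} {K : Finset E3} (hK : K ∈ S) :
    convexHull ℝ (K : Set E3) ⊆ cells S := fun _ hx => mem_biUnion hK hx

/-- At most three points span an affine subspace of dimension at most two. -/
theorem volume_hull_eq_zero_of_card_le {K : Finset E3} (hK : K.card ≤ 3) :
    volume (convexHull ℝ (K : Set E3)) = 0 := by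
  rcases K.eq_empty_or_nonempty with rfl | hne
  · simp
  refine measure_mono_null (convexHull_subset_affineSpan _)
    (Measure.addHaar_affineSubspace _ _ fun htop => ?_)
  have h1 : Module.finrank ℝ (vectorSpan ℝ (K : Set E3)) ≤ 2 := by
    classical
    have hc : 0 < K.card := hne.card_pos
    have := finrank_vectorSpan_image_finset_le ℝ (id : E3 → E3) K (n := K.card - 1) (by omega)
    rw [Finset.image_id] at this
    omega
  have h2 : vectorSpan ℝ (K : Set E3) = ⊤ := by
    rw [← direction_affineSpan, htop, AffineSubspace.direction_top]
  rw [h2, finrank_top, finrank_euclideanSpace_fin] at h1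
  omega

namespace TetMesh

variable (M : TetMesh)

theorem isOpen_core (K : Finset E3) : IsOpen (M.core K) := by
  refine isOpen_interior.sdiff ?_
  exact (Finset.isCompact_biUnion _ fun L _ => isCompact_hull L).isClosed

theorem core_subset_interior (K : Finset E3) : M.core K ⊆ interior (convexHull ℝ (K : Set E3)) :=
  sdiff_subset

theorem core_subset_hull (K : Finset E3) : M.core K ⊆ convexHull ℝ (K : Set E3) :=
  sdiff_subset.trans interior_subset

variable {M}

theorem notMem_hull_of_mem_core {K L : Finset E3} {x : E3} (hx : x ∈ M.core K)
    (hL : L ∈ M.elements) (hLK : L ≠ K) : x ∉ convexHull ℝ (L : Set E3) := fun h =>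
  hx.2 (mem_biUnion (Finset.mem_erase.mpr ⟨hLK, hL⟩) h)

theorem air_subset : M.air ⊆ M.elements := Finset.subset_union_left

theorem conductor_subset : M.conductor ⊆ M.elements := Finset.subset_union_right

theorem volume_hull_inter_hull {K L : Finset E3} (hK : K ∈ M.elements) (hL : L ∈ M.elements)
    (hLK : L ≠ K) :
    volume (convexHull ℝ (K : Set E3) ∩ convexHull ℝ (L : Set E3)) = 0 := by
  classical
  refine measure_mono_null ?_ (volume_hull_eq_zero_of_card_le (K := K ∩ L) ?_)
  · convert! M.conforming K hK L hL
  · have hK4 := M.card_eq K hK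
    have hL4 := M.card_eq L hL
    have hle : (K ∩ L).card ≤ 4 := hK4 ▸ Finset.card_le_card Finset.inter_subset_left
    by_contra hcon
    have h4 : (K ∩ L).card = 4 := by omega
    have e1 := Finset.eq_of_subset_of_card_le (Finset.inter_subset_left : K ∩ L ⊆ K) (by omega)
    have e2 := Finset.eq_of_subset_of_card_le (Finset.inter_subset_right : K ∩ L ⊆ L) (by omega)
    exact hLK (e2.symm.trans e1)

/-- The boundary of a convex set is a null set, and so is the intersection with another element, by
conformity. -/
theorem ae_mem_core_of_mem_hull {K : Finset E3} (hK : K ∈ M.elements) :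
    ∀ᵐ x : E3, x ∈ convexHull ℝ (K : Set E3) → x ∈ M.core K := by
  have h1 : ∀ᵐ x : E3, x ∉ frontier (convexHull ℝ (K : Set E3)) :=
    measure_eq_zero_iff_ae_notMem.mp ((convex_convexHull ℝ _).addHaar_frontier volume)
  have h2 : ∀ᵐ x : E3, ∀ L ∈ M.elements.erase K,
      x ∉ convexHull ℝ (K : Set E3) ∩ convexHull ℝ (L : Set E3) := by
    rw [Filter.eventually_all_finset]
    intro L hL
    exact measure_eq_zero_iff_ae_notMem.mp
      (volume_hull_inter_hull hK (Finset.mem_of_mem_erase hL) (Finset.ne_of_mem_erase hL))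
  filter_upwards [h1, h2] with x hx1 hx2 hxK
  refine ⟨?_, ?_⟩
  · by_contra hni
    exact hx1 ⟨subset_closure hxK, hni⟩
  · simp only [mem_iUnion, not_exists]
    exact fun L hL hxL => hx2 L hL ⟨hxK, hxL⟩

theorem ae_mem_core {S : Finset (Finset E3)} (hS : S ⊆ M.elements) :
    ∀ᵐ x : E3, x ∈ cells S → ∃ K ∈ S, x ∈ M.core K := by
  have : ∀ᵐ x : E3, ∀ K ∈ S, x ∈ convexHull ℝ (K : Set E3) → x ∈ M.core K := by
    rw [Filter.eventually_all_finset]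
    exact fun K hK => ae_mem_core_of_mem_hull (hS hK)
  filter_upwards [this] with x hx hxS
  obtain ⟨K, hK, hxK⟩ := mem_iUnion₂.mp hxS
  exact ⟨K, hK, hx K hK hxK⟩

theorem interior_hull_nonempty {K : Finset E3} (hK : K ∈ M.elements) :
    (interior (convexHull ℝ (K : Set E3))).Nonempty := by
  rw [interior_convexHull_nonempty_iff_affineSpan_eq_top]
  have h := M.affineIndependent K hK
  have := h.affineSpan_eq_top_iff_card_eq_finrank_add_one.mpr (by
    rw [finrank_euclideanSpace_fin, Fintype.card_coe, M.card_eq K hK])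
  simpa using this

theorem core_nonempty {K : Finset E3} (hK : K ∈ M.elements) : (M.core K).Nonempty := by
  by_contra hne
  rw [not_nonempty_iff_eq_empty] at hne
  have h0 : volume (interior (convexHull ℝ (K : Set E3))) = 0 := by
    rw [measure_eq_zero_iff_ae_notMem]
    filter_upwards [ae_mem_core_of_mem_hull hK] with x hx hxK
    have := hx (interior_subset hxK)
    rw [hne] at this
    exact this
  exact (isOpen_interior.measure_pos volume (interior_hull_nonempty hK)).ne' h0

theorem Ω₀_subset_Ω : M.Ω₀ ⊆ M.Ω := by
  apply interior_mono
  exact biUnion_subset_biUnion_left fun K hK => air_subset hK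

theorem Ωc_subset_Ω : M.Ωc ⊆ M.Ω := sdiff_subset

theorem Ω_subset_cells : M.Ω ⊆ cells M.elements := interior_subset

theorem core_subset_Ω {K : Finset E3} (hK : K ∈ M.elements) : M.core K ⊆ M.Ω :=
  (core_subset_interior M K).trans (interior_mono (subset_cells hK))

theorem core_subset_Ωc {K : Finset E3} (hK : K ∈ M.conductor) : M.core K ⊆ M.Ωc := by
  refine fun x hx => ⟨core_subset_Ω (conductor_subset hK) hx, fun hcl => ?_⟩
  obtain ⟨y, hy, hy0⟩ := mem_closure_iff.mp hcl _ (isOpen_core M K) hx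
  obtain ⟨L, hL, hyL⟩ := mem_iUnion₂.mp (interior_subset hy0)
  refine notMem_hull_of_mem_core hy (air_subset hL) ?_ hyL
  rintro rfl
  exact Finset.disjoint_left.mp M.disjoint hL hK

theorem isOpen_Ω : IsOpen M.Ω := isOpen_interior

theorem isOpen_Ω₀ : IsOpen M.Ω₀ := isOpen_interior

theorem isOpen_Ωc : IsOpen M.Ωc := isOpen_Ω.sdiff isClosed_closure

/-- A tetrahedron is the closure of its interior. -/
theorem cells_air_subset_closure : cells M.air ⊆ closure M.Ω₀ := by
  refine iUnion₂_subset fun K hK => ?_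
  have hc := (convex_convexHull ℝ (K : Set E3)).closure_interior_eq_closure_of_nonempty_interior
    (interior_hull_nonempty (air_subset hK))
  calc _ ⊆ closure (convexHull ℝ (K : Set E3)) := subset_closure
    _ = _ := hc.symm
    _ ⊆ _ := closure_mono (interior_mono (subset_cells hK))

theorem Ωc_subset_cells : M.Ωc ⊆ cells M.conductor := by
  intro x hx
  obtain ⟨K, hK, hxK⟩ := mem_iUnion₂.mp (Ω_subset_cells hx.1)
  rcases Finset.mem_union.mp hK with h | h
  · exact absurd (cells_air_subset_closure (subset_cells h hxK)) hx.2
  · exact subset_cells h hxK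

theorem ae_Ω : ∀ᵐ x ∂(volume.restrict M.Ω), ∃ K ∈ M.elements, x ∈ M.core K := by
  rw [ae_restrict_iff' isOpen_Ω.measurableSet]
  filter_upwards [ae_mem_core (M := M) (Finset.Subset.refl _)] with x hx h
  exact hx (Ω_subset_cells h)

theorem ae_Ω₀ : ∀ᵐ x ∂(volume.restrict M.Ω₀), ∃ K ∈ M.air, x ∈ M.core K := by
  rw [ae_restrict_iff' isOpen_Ω₀.measurableSet]
  filter_upwards [ae_mem_core (M := M) air_subset] with x hx h
  exact hx (interior_subset h)

theorem ae_Ωc : ∀ᵐ x ∂(volume.restrict M.Ωc), ∃ K ∈ M.conductor, x ∈ M.core K := by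
  rw [ae_restrict_iff' isOpen_Ωc.measurableSet]
  filter_upwards [ae_mem_core (M := M) conductor_subset] with x hx h
  exact hx (Ωc_subset_cells h)

theorem volume_Ω_lt_top : volume M.Ω < ⊤ :=
  (measure_mono Ω_subset_cells).trans_lt (isCompact_cells _).measure_lt_top

instance : IsFiniteMeasure (volume.restrict M.Ω) := ⟨by simpa using volume_Ω_lt_top⟩

instance : IsFiniteMeasure (volume.restrict M.Ω₀) :=
  ⟨by simpa using (measure_mono Ω₀_subset_Ω).trans_lt volume_Ω_lt_top⟩

instance : IsFiniteMeasure (volume.restrict M.Ωc) :=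
  ⟨by simpa using (measure_mono Ωc_subset_Ω).trans_lt volume_Ω_lt_top⟩

end TetMesh

/-! ### The boundary has finite area -/

/-- A triangle is a Lipschitz image of the unit square. -/
theorem euclideanHausdorffMeasure_triangle_lt_top (p q r : E3) :
    (Measure.euclideanHausdorffMeasure 2 : Measure E3) (convexHull ℝ {p, q, r}) < ⊤ := by
  set g : ℝ × ℝ → E3 := fun z => p + z.1 • ((q + z.2 • (r - q)) - p) with hg
  have hsub : convexHull ℝ ({p, q, r} : Set E3) ⊆ g '' (Icc 0 1 ×ˢ Icc 0 1) := by
    rw [convexHull_insert (by simp), convexHull_pair]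
    intro x hx
    obtain ⟨_, rfl, y, hy, hxy⟩ := mem_convexJoin.mp hx
    rw [segment_eq_image'] at hy hxy
    obtain ⟨t, ht, rfl⟩ := hy
    obtain ⟨s, hs, rfl⟩ := hxy
    exact ⟨(s, t), ⟨hs, ht⟩, rfl⟩
  have hcd : ContDiff ℝ 1 g := by fun_prop
  obtain ⟨C, hC⟩ := (hcd.locallyLipschitz.locallyLipschitzOn
    (s := Icc 0 1 ×ˢ Icc 0 1)).exists_lipschitzOnWith_of_compact
    (isCompact_Icc.prod isCompact_Icc)
  have h1 := hC.hausdorffMeasure_image_le (d := 2) (by norm_num)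
  rw [hausdorffMeasure_prod_real] at h1
  have hfin : (volume : Measure (ℝ × ℝ)) (Icc 0 1 ×ˢ Icc 0 1) < ⊤ :=
    (isCompact_Icc.prod isCompact_Icc).measure_lt_top
  rw [Measure.euclideanHausdorffMeasure_def, Measure.smul_apply]
  refine ENNReal.mul_lt_top ENNReal.coe_lt_top ?_
  refine (measure_mono hsub).trans_lt ?_
  simp only [Nat.cast_ofNat]
  refine h1.trans_lt (ENNReal.mul_lt_top ?_ hfin)
  exact ENNReal.rpow_lt_top_of_nonneg (by norm_num) ENNReal.coe_ne_top

/-- The boundary of a tetrahedron is covered by its four faces: at a boundary point some barycentric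
coordinate vanishes. -/
theorem frontier_hull_subset {K : Finset E3} (hK : K.card = 4)
    (hi : AffineIndependent ℝ ((↑) : K → E3)) [DecidableEq E3] :
    frontier (convexHull ℝ (K : Set E3)) ⊆ ⋃ v ∈ K, convexHull ℝ (K.erase v : Set E3) := by
  have htop : affineSpan ℝ (Set.range ((↑) : K → E3)) = ⊤ :=
    hi.affineSpan_eq_top_iff_card_eq_finrank_add_one.mpr (by
      rw [finrank_euclideanSpace_fin, Fintype.card_coe, hK])
  let b : AffineBasis K ℝ E3 := ⟨(↑), hi, htop⟩
  have hr : Set.range b = (K : Set E3) := by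
    have : Set.range ((↑) : K → E3) = (K : Set E3) := by simp
    exact this
  intro x hx
  rw [(isCompact_hull K).isClosed.frontier_eq] at hx
  obtain ⟨hxK, hxi⟩ := hx
  rw [← hr] at hxK hxi
  rw [AffineBasis.interior_convexHull] at hxi
  rw [AffineBasis.convexHull_eq_nonneg_coord] at hxK
  simp only [mem_ofPred_eq, not_forall, not_lt] at hxi hxK
  obtain ⟨i, hi0⟩ := hxi
  have hi0 : b.coord i x = 0 := le_antisymm hi0 (hxK i)
  refine mem_biUnion (x := (i : E3)) i.2 ?_
  have hx : ∑ j : K, b.coord j x • (j : E3) = x := b.linear_combination_coord_eq_self x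
  rw [← hx, ← Finset.sum_erase (s := Finset.univ) (a := i) (by rw [hi0, zero_smul])]
  have hsum : ∑ j ∈ Finset.univ.erase i, b.coord j x = 1 := by
    rw [Finset.sum_erase (s := Finset.univ) (a := i) hi0]
    exact b.sum_coord_apply_eq_one x
  refine (convex_convexHull ℝ _).sum_mem (fun j _ => hxK j) hsum fun j hj => ?_
  apply subset_convexHull
  simp only [Finset.coe_erase, Set.mem_sdiff, Finset.mem_coe, mem_singleton_iff]
  exact ⟨j.2, fun h => (Finset.ne_of_mem_erase hj) (Subtype.ext h)⟩

theorem frontier_biUnion_subset (S : Finset (Finset E3)) :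
    frontier (cells S) ⊆ ⋃ K ∈ S, frontier (convexHull ℝ (K : Set E3)) := by
  intro x hx
  rw [(isCompact_cells S).isClosed.frontier_eq] at hx
  obtain ⟨hxS, hxi⟩ := hx
  obtain ⟨K, hK, hxK⟩ := mem_iUnion₂.mp hxS
  refine mem_biUnion hK ⟨subset_closure hxK, fun h => hxi ?_⟩
  exact interior_mono (subset_cells hK) h

theorem isFiniteMeasure_surface (M : TetMesh) {Γ : Set E3} (hΓ : Γ ⊆ frontier M.Ω) :
    IsFiniteMeasure (surface Γ) := by
  classical
  refine ⟨?_⟩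
  rw [surface, Measure.restrict_apply_univ]
  have hsub : Γ ⊆ ⋃ K ∈ M.elements, ⋃ v ∈ K, convexHull ℝ (K.erase v : Set E3) := by
    refine (hΓ.trans frontier_interior_subset).trans ((frontier_biUnion_subset _).trans ?_)
    exact iUnion₂_mono fun K hK => frontier_hull_subset (M.card_eq K hK) (M.affineIndependent K hK)
  refine (measure_mono hsub).trans_lt ?_
  refine (measure_biUnion_lt_top M.elements.finite_toSet fun K hK => ?_)
  refine (measure_biUnion_lt_top K.finite_toSet fun v hv => ?_)
  have h3 : (K.erase v).card = 3 := by
    rw [Finset.card_erase_of_mem hv, M.card_eq K hK]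
  obtain ⟨p, q, r, -, -, -, h⟩ := Finset.card_eq_three.mp h3
  rw [h]
  simpa using euclideanHausdorffMeasure_triangle_lt_top p q r

end MeshGeometry

section Fields

/-! ### Calculus -/

/-- `toC3` as a continuous real linear map. -/
def toC3L : E3 →L[ℝ] C3 :=
  ContinuousLinearMap.pi fun i => Complex.ofRealCLM.comp (EuclideanSpace.proj i)

theorem toC3L_apply (x : E3) : toC3L x = toC3 x := rfl

@[fun_prop]
theorem continuous_toC3 : Continuous toC3 := toC3L.continuous

theorem toC3_single (j : Fin 3) : toC3 (EuclideanSpace.single j (1 : ℝ)) = Pi.single j 1 := by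
  ext i
  by_cases h : i = j
  · subst h; simp [toC3]
  · simp [toC3, h]

theorem hasFDerivAt_affine (a : C3) (c : ℂ) (x : E3) :
    HasFDerivAt (fun y => a ⬝ᵥ toC3 y + c)
      (((dotProductBilin ℂ ℂ a).toContinuousLinearMap.restrictScalars ℝ).comp toC3L) x := by
  apply HasFDerivAt.add_const
  exact (((dotProductBilin ℂ ℂ a).toContinuousLinearMap.restrictScalars ℝ).comp toC3L).hasFDerivAt

theorem pd_of_eventuallyEq_affine {φ : E3 → ℂ} {a : C3} {c : ℂ} {x : E3}
    (h : φ =ᶠ[𝓝 x] fun y => a ⬝ᵥ toC3 y + c) (j : Fin 3) : pd j φ x = a j := by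
  rw [pd, ((hasFDerivAt_affine a c x).congr_of_eventuallyEq h).fderiv]
  simp [toC3L_apply, toC3_single]

/-- `∇ × (b × x) = 2 b`. -/
theorem curl_of_eventuallyEq_affine {u : E3 → C3} {a b : C3} {x : E3}
    (h : u =ᶠ[𝓝 x] fun y => a + b ⨯₃ toC3 y) : curl u x = (2 : ℂ) • b := by
  have h0 : (fun y => u y 0) =ᶠ[𝓝 x] fun y => ![0, -b 2, b 1] ⬝ᵥ toC3 y + a 0 := by
    filter_upwards [h] with y hy
    rw [hy]
    simp [cross_apply, dotProduct, Fin.sum_univ_three]; ring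
  have h1 : (fun y => u y 1) =ᶠ[𝓝 x] fun y => ![b 2, 0, -b 0] ⬝ᵥ toC3 y + a 1 := by
    filter_upwards [h] with y hy
    rw [hy]
    simp [cross_apply, dotProduct, Fin.sum_univ_three]; ring
  have h2 : (fun y => u y 2) =ᶠ[𝓝 x] fun y => ![-b 1, b 0, 0] ⬝ᵥ toC3 y + a 2 := by
    filter_upwards [h] with y hy
    rw [hy]
    simp [cross_apply, dotProduct, Fin.sum_univ_three]; ring
  ext i
  fin_cases i <;>
    simp [curl, pd_of_eventuallyEq_affine h0, pd_of_eventuallyEq_affine h1,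
      pd_of_eventuallyEq_affine h2] <;> ring

theorem contDiff_pd {φ : E3 → ℂ} (hφ : ContDiff ℝ (⊤ : ℕ∞) φ) (j : Fin 3) :
    ContDiff ℝ (⊤ : ℕ∞) (pd j φ) := by
  have : ContDiff ℝ (⊤ : ℕ∞) (fderiv ℝ φ) := hφ.fderiv_right (by norm_cast)
  exact this.clm_apply contDiff_const

theorem hasCompactSupport_pd {φ : E3 → ℂ} (hφ : HasCompactSupport φ) (j : Fin 3) :
    HasCompactSupport (pd j φ) :=
  (hφ.fderiv ℝ).comp_left (g := fun L : E3 →L[ℝ] ℂ => L (EuclideanSpace.single j (1 : ℝ))) rfl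

theorem contDiff_component {w : E3 → C3} (hw : ContDiff ℝ (⊤ : ℕ∞) w) (i : Fin 3) :
    ContDiff ℝ (⊤ : ℕ∞) (fun y => w y i) := contDiff_pi.mp hw i

theorem hasCompactSupport_component {w : E3 → C3} (hw : HasCompactSupport w) (i : Fin 3) :
    HasCompactSupport (fun y => w y i) := hw.comp_left (g := fun v : C3 => v i) rfl

theorem continuous_curl {w : E3 → C3} (hw : ContDiff ℝ (⊤ : ℕ∞) w) : Continuous (curl w) := by
  have h : ∀ i j, Continuous (pd j fun y => w y i) := fun i j =>
    (contDiff_pd (contDiff_component hw i) j).continuous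
  refine continuous_pi fun i => ?_
  fin_cases i
  · exact (h 2 1).sub (h 1 2)
  · exact (h 0 2).sub (h 2 0)
  · exact (h 1 0).sub (h 0 1)

theorem curl_eq_zero_of_notMem_tsupport {w : E3 → C3} {x : E3} (hx : x ∉ tsupport w) :
    curl w x = 0 := by
  have h : w =ᶠ[𝓝 x] fun y => 0 + (0 : C3) ⨯₃ toC3 y := by
    filter_upwards [(isClosed_tsupport w).isOpen_compl.mem_nhds hx] with y hy
    simp [image_eq_zero_of_notMem_tsupport hy]
  rw [curl_of_eventuallyEq_affine h, smul_zero]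

theorem hasCompactSupport_curl {w : E3 → C3} (hw : HasCompactSupport w) :
    HasCompactSupport (curl w) :=
  HasCompactSupport.intro hw fun _ hx => curl_eq_zero_of_notMem_tsupport hx

theorem memLp_curl_of_test {w : E3 → C3} (hw : ContDiff ℝ (⊤ : ℕ∞) w) (hc : HasCompactSupport w)
    (μ : Measure E3) [IsFiniteMeasureOnCompacts μ] : MemLp (curl w) 2 μ :=
  (continuous_curl hw).memLp_of_hasCompactSupport (hasCompactSupport_curl hc)

/-! ### Products of square integrable fields -/

theorem memLp_component {u : E3 → C3} {μ : Measure E3} (hu : MemLp u 2 μ) (i : Fin 3) :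
    MemLp (fun x => u x i) 2 μ :=
  (ContinuousLinearMap.proj (R := ℂ) (φ := fun _ : Fin 3 => ℂ) i).comp_memLp' hu

theorem memLp_star {u : E3 → C3} {μ : Measure E3} (hu : MemLp u 2 μ) :
    MemLp (fun x => star (u x)) 2 μ := by
  refine MemLp.of_le hu (continuous_star.comp_aestronglyMeasurable hu.1) ?_
  exact Eventually.of_forall fun x => (norm_star _).le

theorem integrable_dotProduct {u v : E3 → C3} {μ : Measure E3} (hu : MemLp u 2 μ)
    (hv : MemLp v 2 μ) : Integrable (fun x => u x ⬝ᵥ v x) μ := by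
  simp only [dotProduct]
  exact integrable_finsetSum _ fun i _ =>
    (memLp_component hu i).integrable_mul (memLp_component hv i)

/-- The weighted `L²` product `∫_D w u · conj v`, linear in `u` and conjugate linear in `v`. -/
def wform (D : Set E3) (w : E3 → ℝ) (u v : E3 → C3) : ℂ :=
  ∫ x in D, ((w x : ℝ) : ℂ) * (u x ⬝ᵥ star (v x))

/-- Weights for which `wform` is finite on square integrable fields. -/
structure IsBoundedWeight (D : Set E3) (w : E3 → ℝ) : Prop where
  meas : AEStronglyMeasurable w (volume.restrict D)
  bound : ∃ C, ∀ᵐ x ∂(volume.restrict D), |w x| ≤ C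

theorem IsBoundedWeight.add {D : Set E3} {w w' : E3 → ℝ} (h : IsBoundedWeight D w)
    (h' : IsBoundedWeight D w') : IsBoundedWeight D (fun x => w x + w' x) := by
  obtain ⟨C, hC⟩ := h.bound
  obtain ⟨C', hC'⟩ := h'.bound
  refine ⟨h.meas.add h'.meas, C + C', ?_⟩
  filter_upwards [hC, hC'] with x h1 h2
  exact (abs_add_le _ _).trans (add_le_add h1 h2)

theorem IsBoundedWeight.const_mul {D : Set E3} {w : E3 → ℝ} (h : IsBoundedWeight D w) (c : ℝ) :
    IsBoundedWeight D (fun x => c * w x) := by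
  obtain ⟨C, hC⟩ := h.bound
  refine ⟨h.meas.const_mul c, |c| * C, ?_⟩
  filter_upwards [hC] with x h1
  rw [abs_mul]; gcongr

theorem isBoundedWeight_const (D : Set E3) (c : ℝ) : IsBoundedWeight D (fun _ => c) :=
  ⟨aestronglyMeasurable_const, |c|, Eventually.of_forall fun _ => le_rfl⟩

section wform

variable {D : Set E3} {w w' : E3 → ℝ} {u u' v v' : E3 → C3}

theorem integrable_wform (hw : IsBoundedWeight D w) (hu : MemLp u 2 (volume.restrict D))
    (hv : MemLp v 2 (volume.restrict D)) :
    Integrable (fun x => ((w x : ℝ) : ℂ) * (u x ⬝ᵥ star (v x))) (volume.restrict D) := by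
  obtain ⟨C, hC⟩ := hw.bound
  refine (integrable_dotProduct hu (memLp_star hv)).bdd_mul (c := C)
    (Complex.continuous_ofReal.comp_aestronglyMeasurable hw.meas) ?_
  filter_upwards [hC] with x hx
  simpa using hx

theorem wform_congr (hu : u =ᵐ[volume.restrict D] u') (hv : v =ᵐ[volume.restrict D] v') :
    wform D w u v = wform D w u' v' := by
  refine integral_congr_ae ?_
  filter_upwards [hu, hv] with x h1 h2
  rw [h1, h2]

theorem wform_add_left (hw : IsBoundedWeight D w) (hu : MemLp u 2 (volume.restrict D))
    (hu' : MemLp u' 2 (volume.restrict D)) (hv : MemLp v 2 (volume.restrict D)) :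
    wform D w (u + u') v = wform D w u v + wform D w u' v := by
  rw [wform, wform, wform, ← integral_add (integrable_wform hw hu hv) (integrable_wform hw hu' hv)]
  congr 1; ext x
  simp only [Pi.add_apply, add_dotProduct]; ring

theorem wform_smul_left (c : ℂ) : wform D w (c • u) v = c * wform D w u v := by
  rw [wform, wform, ← integral_const_mul]
  congr 1; ext x
  simp only [Pi.smul_apply, smul_dotProduct, smul_eq_mul]; ring

theorem wform_conj_symm (u v : E3 → C3) :
    wform D w u v = (starRingEnd ℂ) (wform D w v u) := by
  rw [wform, wform, ← integral_conj]
  congr 1; ext x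
  simp [dotProduct, mul_comm]

theorem wform_add_right (hw : IsBoundedWeight D w) (hu : MemLp u 2 (volume.restrict D))
    (hv : MemLp v 2 (volume.restrict D)) (hv' : MemLp v' 2 (volume.restrict D)) :
    wform D w u (v + v') = wform D w u v + wform D w u v' := by
  rw [wform_conj_symm, wform_add_left hw hv hv' hu, map_add, ← wform_conj_symm, ← wform_conj_symm]

theorem wform_smul_right (c : ℂ) : wform D w u (c • v) = (starRingEnd ℂ) c * wform D w u v := by
  rw [wform_conj_symm, wform_smul_left, map_mul, ← wform_conj_symm]

theorem wform_add_weight (hw : IsBoundedWeight D w) (hw' : IsBoundedWeight D w')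
    (hu : MemLp u 2 (volume.restrict D)) (hv : MemLp v 2 (volume.restrict D)) :
    wform D (fun x => w x + w' x) u v = wform D w u v + wform D w' u v := by
  rw [wform, wform, wform, ← integral_add (integrable_wform hw hu hv) (integrable_wform hw' hu hv)]
  congr 1; ext x
  push_cast; ring

theorem wform_const_mul_weight (c : ℝ) :
    wform D (fun x => c * w x) u v = c * wform D w u v := by
  rw [wform, wform, ← integral_const_mul]
  congr 1; ext x
  push_cast; ring

theorem dotProduct_star_self (z : C3) : z ⬝ᵥ star z = ((normSq3 z : ℝ) : ℂ) := by
  simp [dotProduct, normSq3, Complex.mul_conj, Complex.normSq_eq_norm_sq]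

theorem normSq3_nonneg (z : C3) : 0 ≤ normSq3 z := Finset.sum_nonneg fun _ _ => sq_nonneg _

theorem normSq3_eq_zero {z : C3} (h : normSq3 z = 0) : z = 0 := by
  rw [normSq3, Finset.sum_eq_zero_iff_of_nonneg fun _ _ => sq_nonneg _] at h
  ext i
  simpa using h i (Finset.mem_univ i)

theorem wform_self (u : E3 → C3) :
    wform D w u u = ((∫ x in D, w x * normSq3 (u x) : ℝ) : ℂ) := by
  rw [wform, ← integral_complex_ofReal]
  congr 1; ext x
  rw [dotProduct_star_self]; push_cast; rfl

theorem wform_self_nonneg (hw : ∀ᵐ x ∂(volume.restrict D), 0 ≤ w x) (u : E3 → C3) :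
    0 ≤ wform D w u u := by
  rw [wform_self, Complex.zero_le_real]
  refine integral_nonneg_of_ae ?_
  filter_upwards [hw] with x hx
  exact mul_nonneg hx (normSq3_nonneg _)

/-- Forms with positive weights are definite. -/
theorem eq_zero_of_wform_self (hw : IsBoundedWeight D w)
    (hpos : ∀ᵐ x ∂(volume.restrict D), 0 < w x) (hu : MemLp u 2 (volume.restrict D))
    (h : wform D w u u = 0) : u =ᵐ[volume.restrict D] 0 := by
  have hint := (integrable_wform hw hu hu).re
  rw [wform_self, Complex.ofReal_eq_zero] at h
  have h2 : Integrable (fun x => w x * normSq3 (u x)) (volume.restrict D) := by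
    refine hint.congr (Eventually.of_forall fun x => ?_)
    simp [dotProduct_star_self, ← Complex.ofReal_mul]
  rw [integral_eq_zero_iff_of_nonneg_ae ?_ h2] at h
  · filter_upwards [h, hpos] with x hx hp
    exact normSq3_eq_zero ((mul_eq_zero.mp hx).resolve_left hp.ne')
  · filter_upwards [hpos] with x hx
    exact mul_nonneg hx.le (normSq3_nonneg _)

end wform

end Fields

section EdgeElements

/-! ### Piecewise affine fields -/

/-- Coefficients `(a_K, b_K)` of a field `a_K + b_K × x`, one pair for each element. -/
abbrev Coef (M : TetMesh) : Type := M.elements → C3 × C3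

/-- The field with coefficients `c`, equal to `a_K + b_K × x` on each element `K`. On points of
several elements the values are added up, as in `edgeSpace`. -/
def field (M : TetMesh) : Coef M →ₗ[ℂ] (E3 → C3) where
  toFun c x := ∑ K : M.elements,
    (convexHull ℝ (K.1 : Set E3)).indicator (fun y => (c K).1 + (c K).2 ⨯₃ toC3 y) x
  map_add' c d := by
    ext1 x
    simp only [Pi.add_apply, ← Finset.sum_add_distrib]
    refine Finset.sum_congr rfl fun K _ => ?_
    by_cases hx : x ∈ convexHull ℝ (K.1 : Set E3)
    · simp only [indicator_of_mem hx, Prod.fst_add, Prod.snd_add, map_add, LinearMap.add_apply]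
      abel
    · simp only [indicator_of_notMem hx, add_zero]
  map_smul' r c := by
    ext1 x
    simp only [Pi.smul_apply, Finset.smul_sum, RingHom.id_apply]
    refine Finset.sum_congr rfl fun K _ => ?_
    rw [← Set.indicator_const_smul_apply]
    congr 1
    ext1 y
    simp only [Prod.smul_fst, Prod.smul_snd, map_smul, LinearMap.smul_apply, smul_add]

variable {M : TetMesh}

theorem field_apply (c : Coef M) (x : E3) : field M c x = ∑ K : M.elements,
    (convexHull ℝ (K.1 : Set E3)).indicator (fun y => (c K).1 + (c K).2 ⨯₃ toC3 y) x := rfl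

@[fun_prop]
theorem continuous_cross_toC3 (a b : C3) : Continuous fun y : E3 => a + b ⨯₃ toC3 y := by
  have : Continuous fun y : E3 => (crossProduct b) (toC3 y) :=
    (LinearMap.continuous_of_finiteDimensional (crossProduct b)).comp continuous_toC3
  exact continuous_const.add this

theorem measurable_field (c : Coef M) : Measurable (field M c) := by
  have : (field M c) = fun x => ∑ K : M.elements,
    (convexHull ℝ (K.1 : Set E3)).indicator (fun y => (c K).1 + (c K).2 ⨯₃ toC3 y) x := rfl
  rw [this]
  refine Finset.measurable_fun_sum _ fun K _ => ?_
  exact (continuous_cross_toC3 _ _).measurable.indicator (isCompact_hull _).measurableSet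

theorem exists_bound_field (c : Coef M) : ∃ C, ∀ x, ‖field M c x‖ ≤ C := by
  have h : ∀ K : M.elements, ∃ C, ∀ x ∈ convexHull ℝ (K.1 : Set E3),
      ‖(c K).1 + (c K).2 ⨯₃ toC3 x‖ ≤ C := fun K =>
    (isCompact_hull _).exists_bound_of_continuousOn (continuous_cross_toC3 _ _).continuousOn
  choose C hC using h
  refine ⟨∑ K, |C K|, fun x => ?_⟩
  rw [field_apply]
  refine (norm_sum_le _ _).trans (Finset.sum_le_sum fun K _ => ?_)
  by_cases hx : x ∈ convexHull ℝ (K.1 : Set E3)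
  · rw [indicator_of_mem hx]; exact (hC K x hx).trans (le_abs_self _)
  · rw [indicator_of_notMem hx]; simp

theorem memLp_field (c : Coef M) (μ : Measure E3) [IsFiniteMeasure μ] (p : ENNReal) :
    MemLp (field M c) p μ := by
  obtain ⟨C, hC⟩ := exists_bound_field c
  exact MemLp.of_bound (measurable_field c).aestronglyMeasurable C (Eventually.of_forall hC)

theorem field_of_mem_core (c : Coef M) (K : M.elements) {x : E3} (hx : x ∈ M.core K) :
    field M c x = (c K).1 + (c K).2 ⨯₃ toC3 x := by
  rw [field_apply, Finset.sum_eq_single K, indicator_of_mem (M.core_subset_hull K hx)]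
  · intro L _ hL
    exact indicator_of_notMem (TetMesh.notMem_hull_of_mem_core hx L.2
      (fun h => hL (Subtype.ext h))) _
  · simp

theorem field_eventuallyEq (c : Coef M) (K : M.elements) {x : E3} (hx : x ∈ M.core K) :
    field M c =ᶠ[𝓝 x] fun y => (c K).1 + (c K).2 ⨯₃ toC3 y := by
  filter_upwards [(M.isOpen_core K).mem_nhds hx] with y hy
  exact field_of_mem_core c K hy

/-- The coefficients `(2 b_K, 0)` of the elementwise curl. -/
def curlCoef (M : TetMesh) : Coef M →ₗ[ℂ] Coef M :=
  LinearMap.pi fun K => ((2 : ℂ) • (LinearMap.inl ℂ C3 C3 ∘ₗ LinearMap.snd ℂ C3 C3)) ∘ₗ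
    LinearMap.proj K

theorem curlCoef_apply (c : Coef M) (K : M.elements) :
    curlCoef M c K = ((2 : ℂ) • (c K).2, 0) := by
  simp [curlCoef]

theorem curl_field_of_mem_core (c : Coef M) (K : M.elements) {x : E3} (hx : x ∈ M.core K) :
    curl (field M c) x = (2 : ℂ) • (c K).2 :=
  curl_of_eventuallyEq_affine (field_eventuallyEq c K hx)

theorem curl_field_ae (c : Coef M) :
    curl (field M c) =ᵐ[volume.restrict M.Ω] field M (curlCoef M c) := by
  filter_upwards [M.ae_Ω] with x ⟨K, hK, hx⟩
  rw [curl_field_of_mem_core c ⟨K, hK⟩ hx, field_of_mem_core _ ⟨K, hK⟩ hx, curlCoef_apply]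
  simp

/-- An elementwise curl that vanishes almost everywhere has vanishing coefficients, because every
core has positive volume. -/
theorem coef_eq_zero_of_field_ae {c : Coef M}
    (h : field M (curlCoef M c) =ᵐ[volume.restrict M.Ω] 0) : curlCoef M c = 0 := by
  ext1 K
  by_contra hne
  have hne2 : (2 : ℂ) • (c K).2 ≠ 0 := by
    intro h0
    rw [curlCoef_apply, h0] at hne
    exact hne rfl
  have h0 : volume (M.core K) = 0 := by
    rw [measure_eq_zero_iff_ae_notMem]
    rw [EventuallyEq, ae_restrict_iff' TetMesh.isOpen_Ω.measurableSet] at h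
    filter_upwards [h] with x hx hxK
    have := hx (TetMesh.core_subset_Ω K.2 hxK)
    rw [field_of_mem_core _ K hxK, curlCoef_apply] at this
    simp only [map_zero, LinearMap.zero_apply, add_zero, Pi.zero_apply] at this
    exact hne2 this
  exact ((M.isOpen_core K).measure_pos volume (TetMesh.core_nonempty K.2)).ne' h0

/-! ### The edge element space as a submodule -/

theorem MemHcurl.zero (D Γ : Set E3) : MemHcurl D Γ 0 :=
  ⟨MemLp.zero', 0, MemLp.zero', fun w _ _ _ => by simp⟩

theorem MemHcurl.add {D Γ : Set E3} {u u' : E3 → C3} (h : MemHcurl D Γ u) (h' : MemHcurl D Γ u') :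
    MemHcurl D Γ (u + u') := by
  obtain ⟨hu, v, hv, H⟩ := h
  obtain ⟨hu', v', hv', H'⟩ := h'
  refine ⟨hu.add hu', v + v', hv.add hv', fun w hw hc hd => ?_⟩
  have hcw := memLp_curl_of_test hw hc (volume.restrict D)
  have hww : MemLp w 2 (volume.restrict D) := hw.continuous.memLp_of_hasCompactSupport hc
  simp only [Pi.add_apply, add_dotProduct]
  rw [integral_add (integrable_dotProduct hu hcw) (integrable_dotProduct hu' hcw),
    integral_add (integrable_dotProduct hv hww) (integrable_dotProduct hv' hww), H w hw hc hd,
    H' w hw hc hd]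

theorem MemHcurl.smul {D Γ : Set E3} {u : E3 → C3} (r : ℂ) (h : MemHcurl D Γ u) :
    MemHcurl D Γ (r • u) := by
  obtain ⟨hu, v, hv, H⟩ := h
  refine ⟨hu.const_smul r, r • v, hv.const_smul r, fun w hw hc hd => ?_⟩
  simp only [Pi.smul_apply, smul_dotProduct, integral_smul]
  rw [H w hw hc hd]

/-- The coefficients of the edge element space: those whose field is in `H_Γ(curl; Ω)`. -/
def edgeCoef (M : TetMesh) (Γ : Set E3) : Submodule ℂ (Coef M) where
  carrier := {c | MemHcurl M.Ω Γ (field M c)}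
  zero_mem' := by
    change MemHcurl _ _ (field M 0)
    rw [map_zero]; exact MemHcurl.zero _ _
  add_mem' h h' := by
    change MemHcurl _ _ (field M _)
    rw [map_add]; exact h.add h'
  smul_mem' r c h := by
    change MemHcurl _ _ (field M _)
    rw [map_smul]; exact h.smul r

theorem mem_edgeCoef {Γ : Set E3} {c : Coef M} : c ∈ edgeCoef M Γ ↔ MemHcurl M.Ω Γ (field M c) :=
  Iff.rfl

/-- Pointwise values and coefficients determine each other, so that `edgeSpace` is an image. -/
theorem edgeSpace_eq (Γ : Set E3) : edgeSpace M Γ = field M '' (edgeCoef M Γ) := by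
  ext u
  constructor
  · rintro ⟨h, a, b, hab⟩
    have hu : field M (fun K => (a K, b K)) = u := by
      ext1 x
      rw [hab, field_apply]
      exact Finset.sum_coe_sort M.elements fun K =>
        (convexHull ℝ (K : Set E3)).indicator (fun y => a K + b K ⨯₃ toC3 y) x
    exact ⟨_, by rw [SetLike.mem_coe, mem_edgeCoef, hu]; exact h, hu⟩
  · rintro ⟨c, hc, rfl⟩
    classical
    refine ⟨hc, fun K => if h : K ∈ M.elements then (c ⟨K, h⟩).1 else 0,
      fun K => if h : K ∈ M.elements then (c ⟨K, h⟩).2 else 0, fun x => ?_⟩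
    rw [field_apply, ← Finset.sum_coe_sort M.elements]
    refine Finset.sum_congr rfl fun K _ => ?_
    simp

/-! ### Representation of forms by operators -/

section Riesz

variable {H : Type*} [NormedAddCommGroup H] [InnerProductSpace ℂ H]

/-- A weighted `L²` form of the fields with coefficients `γ E` is represented by an operator, even
where the form is degenerate. -/
theorem exists_operator_of_wform [FiniteDimensional ℂ H] (γ : H →ₗ[ℂ] Coef M) {D : Set E3}
    [IsFiniteMeasure (volume.restrict D)] {w : E3 → ℝ} (hw : IsBoundedWeight D w) :
    ∃ A : H →L[ℂ] H, ∀ E F, ⟪F, A E⟫_ℂ = wform D w (field M (γ E)) (field M (γ F)) := by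
  have hm : ∀ c : Coef M, MemLp (field M c) 2 (volume.restrict D) := fun c => memLp_field c _ _
  let B : H →ₗ⋆[ℂ] H →ₗ[ℂ] ℂ := LinearMap.mk₂'ₛₗ (starRingEnd ℂ) (RingHom.id ℂ)
    (fun F E => wform D w (field M (γ E)) (field M (γ F)))
    (fun F F' E => by simp only [map_add]; exact wform_add_right hw (hm _) (hm _) (hm _))
    (fun r F E => by simp only [map_smul]; exact wform_smul_right r)
    (fun F E E' => by simp only [map_add]; exact wform_add_left hw (hm _) (hm _) (hm _))
    (fun r F E => by simp only [map_smul]; exact wform_smul_left r)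
  let b := stdOrthonormalBasis ℂ H
  let A : H →ₗ[ℂ] H := ∑ i, (B (b i)).smulRight (b i)
  refine ⟨A.toContinuousLinearMap, fun E F => ?_⟩
  have h1 : B F E = ∑ i, (starRingEnd ℂ) ⟪b i, F⟫_ℂ * B (b i) E := by
    conv_lhs => rw [← b.sum_repr F]
    simp [map_sum, LinearMap.sum_apply, OrthonormalBasis.repr_apply_apply]
  change ⟪F, A E⟫_ℂ = B F E
  rw [h1]
  simp only [A, LinearMap.sum_apply, LinearMap.smulRight_apply, inner_sum, inner_smul_right]
  refine Finset.sum_congr rfl fun i _ => ?_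
  rw [inner_conj_symm, mul_comm]

theorem isPositive_of_wform {A : H →L[ℂ] H} {γ : H →ₗ[ℂ] Coef M} {D : Set E3} {w : E3 → ℝ}
    (hA : ∀ E F, ⟪F, A E⟫_ℂ = wform D w (field M (γ E)) (field M (γ F)))
    (hw : ∀ᵐ x ∂(volume.restrict D), 0 ≤ w x) : A.IsPositive := by
  rw [ContinuousLinearMap.isPositive_iff_complex]
  intro x
  have h0 : 0 ≤ ⟪x, A x⟫_ℂ := by rw [hA]; exact wform_self_nonneg hw _
  have h1 : ⟪A x, x⟫_ℂ = ⟪x, A x⟫_ℂ := by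
    rw [← inner_conj_symm]
    exact (Complex.conj_eq_iff_im.mpr (Complex.nonneg_iff.mp h0).2.symm)
  rw [h1]
  obtain ⟨hr, hi⟩ := Complex.nonneg_iff.mp h0
  exact ⟨Complex.ext (by simp) (by simpa using hi), hr⟩

end Riesz

end EdgeElements

section Multipliers

variable {M : TetMesh} {Γ : Set E3}

/-! ### Multipliers -/

theorem eventuallyEq_of_mem_core {β : Type*} {f g : E3 → β} {K : Finset E3} {x : E3}
    (hx : x ∈ M.core K) (h : ∀ y ∈ convexHull ℝ (K : Set E3), f y = g y) : f =ᶠ[𝓝 x] g := by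
  filter_upwards [(M.isOpen_core K).mem_nhds hx] with y hy
  exact h y (M.core_subset_hull K hy)

theorem grad_of_affineOn {φ : E3 → ℂ} {K : Finset E3} {a : C3} {c : ℂ} {x : E3}
    (hx : x ∈ M.core K) (h : ∀ y ∈ convexHull ℝ (K : Set E3), φ y = a ⬝ᵥ toC3 y + c) :
    grad φ x = a := by
  ext j
  exact pd_of_eventuallyEq_affine (eventuallyEq_of_mem_core hx h) j

/-- The coefficients whose field is, almost everywhere in `Ω₀`, the gradient of a multiplier. The
coefficients on elements outside `Ω₀` are arbitrary. -/
def multCoef (M : TetMesh) (Γ : Set E3) : Submodule ℂ (Coef M) where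
  carrier := {c | ∃ φ ∈ multiplierSpace M Γ, grad φ =ᵐ[volume.restrict M.Ω₀] field M c}
  zero_mem' := by
    refine ⟨0, ⟨continuousOn_const, fun K _ => ⟨0, 0, fun x _ => by simp⟩, fun x _ => rfl⟩, ?_⟩
    filter_upwards [M.ae_Ω₀] with x ⟨K, hK, hx⟩
    rw [grad_of_affineOn (a := 0) (c := 0) hx (by simp), map_zero]; rfl
  add_mem' := by
    rintro c c' ⟨φ, ⟨h1, h2, h3⟩, h4⟩ ⟨φ', ⟨h1', h2', h3'⟩, h4'⟩
    refine ⟨φ + φ', ⟨h1.add h1', fun K hK => ?_, fun x hx => ?_⟩, ?_⟩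
    · obtain ⟨a, b, hab⟩ := h2 K hK
      obtain ⟨a', b', hab'⟩ := h2' K hK
      refine ⟨a + a', b + b', fun x hx => ?_⟩
      rw [Pi.add_apply, hab x hx, hab' x hx, add_dotProduct]; ring
    · rw [Pi.add_apply, h3 x hx, h3' x hx, add_zero]
    · filter_upwards [M.ae_Ω₀, h4, h4'] with x ⟨K, hK, hx⟩ e e'
      obtain ⟨a, b, hab⟩ := h2 K hK
      obtain ⟨a', b', hab'⟩ := h2' K hK
      rw [map_add, Pi.add_apply, ← e, ← e', grad_of_affineOn hx hab, grad_of_affineOn hx hab']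
      refine grad_of_affineOn (c := b + b') hx fun y hy => ?_
      rw [Pi.add_apply, hab y hy, hab' y hy, add_dotProduct]; ring
  smul_mem' := by
    rintro r c ⟨φ, ⟨h1, h2, h3⟩, h4⟩
    refine ⟨r • φ, ⟨h1.const_smul r, fun K hK => ?_, fun x hx => ?_⟩, ?_⟩
    · obtain ⟨a, b, hab⟩ := h2 K hK
      refine ⟨r • a, r * b, fun x hx => ?_⟩
      rw [Pi.smul_apply, hab x hx, smul_dotProduct, smul_eq_mul, smul_eq_mul]; ring
    · rw [Pi.smul_apply, h3 x hx, smul_zero]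
    · filter_upwards [M.ae_Ω₀, h4] with x ⟨K, hK, hx⟩ e
      obtain ⟨a, b, hab⟩ := h2 K hK
      rw [map_smul, Pi.smul_apply, ← e, grad_of_affineOn hx hab]
      refine grad_of_affineOn (c := r * b) hx fun y hy => ?_
      rw [Pi.smul_apply, hab y hy, smul_dotProduct, smul_eq_mul, smul_eq_mul]; ring

/-- The gradient of every multiplier is, almost everywhere in `Ω₀`, a field with coefficients. -/
theorem exists_multCoef {φ : E3 → ℂ} (hφ : φ ∈ multiplierSpace M Γ) :
    ∃ c ∈ multCoef M Γ, grad φ =ᵐ[volume.restrict M.Ω₀] field M c := by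
  classical
  choose! a b hab using hφ.2.1
  let c : Coef M := fun K => (a K, 0)
  have h : grad φ =ᵐ[volume.restrict M.Ω₀] field M c := by
    filter_upwards [M.ae_Ω₀] with x ⟨K, hK, hx⟩
    rw [grad_of_affineOn hx (hab K hK), field_of_mem_core c ⟨K, TetMesh.air_subset hK⟩ hx]
    simp [c]
  exact ⟨c, ⟨φ, hφ, h⟩, h⟩

/-! ### Conductivities -/

/-- The conductivity space as a submodule. -/
def condSubmodule (M : TetMesh) : Submodule ℝ (E3 → ℝ) where
  carrier := conductivitySpace M
  zero_mem' := ⟨continuous_const, fun _ _ => rfl, fun K _ => ⟨0, 0, fun x _ => by simp⟩⟩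
  add_mem' := by
    rintro σ σ' ⟨h1, h2, h3⟩ ⟨h1', h2', h3'⟩
    refine ⟨h1.add h1', fun x hx => ?_, fun K hK => ?_⟩
    · rw [Pi.add_apply, h2 x hx, h2' x hx, add_zero]
    · obtain ⟨a, b, hab⟩ := h3 K hK
      obtain ⟨a', b', hab'⟩ := h3' K hK
      refine ⟨a + a', b + b', fun x hx => ?_⟩
      rw [Pi.add_apply, hab x hx, hab' x hx, inner_add_left]; ring
  smul_mem' := by
    rintro r σ ⟨h1, h2, h3⟩
    refine ⟨h1.const_smul r, fun x hx => ?_, fun K hK => ?_⟩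
    · rw [Pi.smul_apply, h2 x hx, smul_zero]
    · obtain ⟨a, b, hab⟩ := h3 K hK
      refine ⟨r • a, r * b, fun x hx => ?_⟩
      rw [Pi.smul_apply, hab x hx, inner_smul_left, smul_eq_mul]
      simp; ring

theorem nonneg_on_hull_of_affine {K : Finset E3} {a : E3} {c : ℝ}
    (h : ∀ v ∈ K, 0 ≤ inner ℝ a v + c) {x : E3} (hx : x ∈ convexHull ℝ (K : Set E3)) :
    0 ≤ inner ℝ a x + c := by
  have hconv : Convex ℝ {x : E3 | -c ≤ inner ℝ a x} :=
    convex_halfSpace_ge (f := fun x => inner ℝ a x)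
      ⟨fun x y => inner_add_right _ _ _, fun r x => real_inner_smul_right _ _ _⟩ (-c)
  have := convexHull_min (s := (K : Set E3)) (fun v hv => by
    have := h v hv
    change -c ≤ inner ℝ a v
    linarith) hconv hx
  change -c ≤ inner ℝ a x at this
  linarith

/-- Inequalities between conductivities only have to be checked at the vertices. -/
theorem le_on_Ωc_of_le_on_vertices {σ τ : E3 → ℝ} (hσ : σ ∈ conductivitySpace M)
    (hτ : τ ∈ conductivitySpace M) (c s : ℝ)
    (h : ∀ K ∈ M.conductor, ∀ v ∈ K, c * (s + σ v) ≤ s + τ v) {x : E3} (hx : x ∈ M.Ωc) :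
    c * (s + σ x) ≤ s + τ x := by
  obtain ⟨K, hK, hxK⟩ := mem_iUnion₂.mp (TetMesh.Ωc_subset_cells hx)
  obtain ⟨a, b, hab⟩ := hσ.2.2 K hK
  obtain ⟨a', b', hab'⟩ := hτ.2.2 K hK
  have key : ∀ y, inner ℝ (a' - c • a) y + (s + b' - c * (s + b)) =
      (s + (inner ℝ a' y + b')) - c * (s + (inner ℝ a y + b)) := by
    intro y
    rw [inner_sub_left, real_inner_smul_left]; ring
  have := nonneg_on_hull_of_affine (a := a' - c • a) (c := s + b' - c * (s + b))
    (fun v hv => ?_) hxK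
  · rw [key, ← hab x hxK, ← hab' x hxK] at this; linarith
  · have hvK := subset_convexHull ℝ (K : Set E3) hv
    rw [key, ← hab v hvK, ← hab' v hvK]
    linarith [h K hK v hv]

/-- A conductivity is determined by its values at the vertices. -/
instance : FiniteDimensional ℝ (condSubmodule M) := by
  let ev : condSubmodule M →ₗ[ℝ] (↥(M.conductor.biUnion id) → ℝ) :=
    { toFun := fun σ v => σ.1 v
      map_add' := fun _ _ => rfl
      map_smul' := fun _ _ => rfl }
  refine FiniteDimensional.of_injective ev ?_
  rw [← LinearMap.ker_eq_bot, LinearMap.ker_eq_bot']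
  intro σ hσ
  have hv : ∀ K ∈ M.conductor, ∀ v ∈ K, σ.1 v = 0 := fun K hK v hv =>
    congrFun hσ ⟨v, Finset.mem_biUnion.mpr ⟨K, hK, hv⟩⟩
  ext x
  by_cases hx : x ∈ M.Ωc
  swap
  · exact σ.2.2.1 x hx
  have h1 := le_on_Ωc_of_le_on_vertices (c := 1) (s := 0) σ.2 (condSubmodule M).zero_mem
    (fun K hK v hvK => by simp [hv K hK v hvK]) hx
  have h2 := le_on_Ωc_of_le_on_vertices (c := 1) (s := 0) (condSubmodule M).zero_mem σ.2
    (fun K hK v hvK => by simp [hv K hK v hvK]) hx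
  simp at h1 h2
  exact le_antisymm h1 h2

theorem isBoundedWeight_of_conductivity {σ : E3 → ℝ} (hσ : σ ∈ conductivitySpace M) :
    IsBoundedWeight M.Ωc σ := by
  obtain ⟨C, hC⟩ := (isCompact_cells M.elements).exists_bound_of_continuousOn hσ.1.continuousOn
  refine ⟨hσ.1.aestronglyMeasurable, C, ?_⟩
  rw [ae_restrict_iff' TetMesh.isOpen_Ωc.measurableSet]
  exact Eventually.of_forall fun x hx => hC x (TetMesh.Ω_subset_cells (TetMesh.Ωc_subset_Ω hx))

theorem hasGradientAt_of_affineOn {σ : E3 → ℝ} {K : Finset E3} {a : E3} {c : ℝ} {x : E3}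
    (hx : x ∈ M.core K) (h : ∀ y ∈ convexHull ℝ (K : Set E3), σ y = inner ℝ a y + c) :
    HasGradientAt σ a x := by
  have h0 : HasFDerivAt (fun y : E3 => inner ℝ a y + c) (InnerProductSpace.toDual ℝ E3 a) x :=
    ((InnerProductSpace.toDual ℝ E3 a).hasFDerivAt (x := x)).add_const c
  exact h0.congr_of_eventuallyEq (eventuallyEq_of_mem_core hx h)

theorem gradient_add_ae {σ σ' : E3 → ℝ} (hσ : σ ∈ conductivitySpace M)
    (hσ' : σ' ∈ conductivitySpace M) :
    gradient (σ + σ') =ᵐ[volume.restrict M.Ωc] gradient σ + gradient σ' := by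
  filter_upwards [M.ae_Ωc] with x ⟨K, hK, hx⟩
  obtain ⟨a, b, hab⟩ := hσ.2.2 K hK
  obtain ⟨a', b', hab'⟩ := hσ'.2.2 K hK
  rw [Pi.add_apply, (hasGradientAt_of_affineOn hx hab).gradient,
    (hasGradientAt_of_affineOn hx hab').gradient]
  refine (hasGradientAt_of_affineOn (c := b + b') hx fun y hy => ?_).gradient
  rw [Pi.add_apply, hab y hy, hab' y hy, inner_add_left]; ring

theorem gradient_smul_ae {σ : E3 → ℝ} (hσ : σ ∈ conductivitySpace M) (r : ℝ) :
    gradient (r • σ) =ᵐ[volume.restrict M.Ωc] r • gradient σ := by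
  filter_upwards [M.ae_Ωc] with x ⟨K, hK, hx⟩
  obtain ⟨a, b, hab⟩ := hσ.2.2 K hK
  rw [Pi.smul_apply, (hasGradientAt_of_affineOn hx hab).gradient]
  refine (hasGradientAt_of_affineOn (c := r * b) hx fun y hy => ?_).gradient
  rw [Pi.smul_apply, hab y hy, real_inner_smul_left, smul_eq_mul]; ring

theorem memLp_gradient {σ : E3 → ℝ} (hσ : σ ∈ conductivitySpace M) :
    MemLp (gradient σ) 2 (volume.restrict M.Ωc) := by
  choose! a b hab using hσ.2.2
  have hmeas : Measurable (gradient σ) :=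
    (InnerProductSpace.toDual ℝ E3).symm.continuous.measurable.comp (measurable_fderiv ℝ σ)
  refine MemLp.of_bound hmeas.aestronglyMeasurable (∑ K ∈ M.conductor, ‖a K‖) ?_
  filter_upwards [M.ae_Ωc] with x ⟨K, hK, hx⟩
  rw [(hasGradientAt_of_affineOn hx (hab K hK)).gradient]
  exact Finset.single_le_sum (f := fun K => ‖a K‖) (fun _ _ => norm_nonneg _) hK

/-- A conductivity with vanishing gradient takes finitely many values, hence is constant, hence
vanishes. -/
theorem eq_zero_of_gradient_ae_eq_zero {σ : E3 → ℝ} (hσ : σ ∈ conductivitySpace M)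
    (h : gradient σ =ᵐ[volume.restrict M.Ωc] 0) : σ = 0 := by
  choose! a b hab using hσ.2.2
  have ha : ∀ K ∈ M.conductor, a K = 0 := by
    intro K hK
    by_contra hne
    have h0 : volume (M.core K) = 0 := by
      rw [measure_eq_zero_iff_ae_notMem]
      rw [EventuallyEq, ae_restrict_iff' TetMesh.isOpen_Ωc.measurableSet] at h
      filter_upwards [h] with x hx hxK
      have := hx (TetMesh.core_subset_Ωc hK hxK)
      rw [(hasGradientAt_of_affineOn hxK (hab K hK)).gradient] at this
      exact hne this
    exact ((M.isOpen_core K).measure_pos volume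
      (TetMesh.core_nonempty (TetMesh.conductor_subset hK))).ne' h0
  have hfin : (range σ).Finite := by
    refine ((M.conductor.image b).finite_toSet.union (finite_singleton 0)).subset ?_
    rintro _ ⟨x, rfl⟩
    by_cases hx : x ∈ M.Ωc
    · left
      obtain ⟨K, hK, hxK⟩ := mem_iUnion₂.mp (TetMesh.Ωc_subset_cells hx)
      rw [hab K hK x hxK, ha K hK, inner_zero_left, zero_add]
      exact Finset.mem_coe.mpr (Finset.mem_image_of_mem b hK)
    · right; exact hσ.2.1 x hx
  have hsub : (range σ).Subsingleton :=
    hfin.countable.isTotallyDisconnected _ Subset.rfl (isPreconnected_range hσ.1)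
  obtain ⟨x₀, hx₀⟩ : ∃ x₀, x₀ ∉ M.Ωc := by
    by_contra! hall
    have : IsCompact (univ : Set E3) := (isCompact_cells M.elements).of_isClosed_subset
      isClosed_univ
      fun x _ => TetMesh.Ω_subset_cells (TetMesh.Ωc_subset_Ω (hall x))
    exact noncompact_univ E3 this
  ext x
  rw [hsub ⟨x, rfl⟩ ⟨x₀, rfl⟩, hσ.2.1 x₀ hx₀]; rfl

/-! ### Linear maps into `L²` -/

/-- A family of square integrable functions that depends linearly on a parameter up to null sets
defines a linear map into `L²`. -/
theorem exists_linearMap_Lp {𝕜 H X F : Type*} [RCLike 𝕜] [AddCommGroup H] [Module 𝕜 H]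
    [MeasurableSpace X] {μ : Measure X} [NormedAddCommGroup F] [NormedSpace 𝕜 F] (p : H → X → F)
    (hp : ∀ E, MemLp (p E) 2 μ) (hadd : ∀ E E', p (E + E') =ᵐ[μ] p E + p E')
    (hsmul : ∀ (r : 𝕜) E, p (r • E) =ᵐ[μ] r • p E) :
    ∃ L : H →ₗ[𝕜] Lp F 2 μ, ∀ E, L E = (hp E).toLp (p E) :=
  ⟨{ toFun := fun E => (hp E).toLp (p E)
     map_add' := fun E E' => by
      rw [← MemLp.toLp_add]; exact MemLp.toLp_congr _ _ (hadd E E')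
     map_smul' := fun r E => by
      rw [RingHom.id_apply, ← MemLp.toLp_const_smul]; exact MemLp.toLp_congr _ _ (hsmul r E) },
    fun _ => rfl⟩

theorem norm_toLp_sq (𝕜 : Type*) {X F : Type*} [RCLike 𝕜] [MeasurableSpace X] {μ : Measure X}
    [NormedAddCommGroup F] [InnerProductSpace 𝕜 F] {f : X → F} (hf : MemLp f 2 μ) :
    ‖hf.toLp f‖ ^ 2 = ∫ x, ‖f x‖ ^ 2 ∂μ := by
  rw [← inner_self_eq_norm_sq (𝕜 := 𝕜), L2.inner_def]
  have : ∫ x, ⟪(hf.toLp f) x, (hf.toLp f) x⟫_𝕜 ∂μ = ∫ x, ((‖f x‖ ^ 2 : ℝ) : 𝕜) ∂μ := by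
    refine integral_congr_ae ?_
    filter_upwards [hf.coeFn_toLp] with x hx
    rw [hx, inner_self_eq_norm_sq_to_K]; push_cast; rfl
  rw [this, integral_ofReal, RCLike.ofReal_re]

/-! ### Tangential traces -/

theorem norm_cross_le (u v : C3) : ‖u ⨯₃ v‖ ≤ 2 * ‖u‖ * ‖v‖ := by
  rw [pi_norm_le_iff_of_nonneg (by positivity)]
  have hb : ∀ i j k l : Fin 3, ‖u i * v j - u k * v l‖ ≤ 2 * ‖u‖ * ‖v‖ := by
    intro i j k l
    refine (norm_sub_le _ _).trans ?_
    rw [norm_mul, norm_mul]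
    have h1 : ‖u i‖ * ‖v j‖ ≤ ‖u‖ * ‖v‖ := by gcongr <;> exact norm_le_pi_norm _ _
    have h2 : ‖u k‖ * ‖v l‖ ≤ ‖u‖ * ‖v‖ := by gcongr <;> exact norm_le_pi_norm _ _
    linarith
  intro i
  fin_cases i <;> simp [cross_apply] <;> exact hb _ _ _ _

theorem aestronglyMeasurable_cross {X : Type*} [MeasurableSpace X] {μ : Measure X} {u v : X → C3}
    (hu : AEStronglyMeasurable u μ) (hv : AEStronglyMeasurable v μ) :
    AEStronglyMeasurable (fun x => u x ⨯₃ v x) μ := by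
  have hc : Continuous fun z : C3 × C3 => z.1 ⨯₃ z.2 := by
    refine continuous_pi fun i => ?_
    fin_cases i <;> simp [cross_apply] <;> fun_prop
  have h := hc.comp_aestronglyMeasurable (hu.prodMk hv)
  exact h

theorem memLp_trace {μ : Measure E3} [IsFiniteMeasure μ] {n : E3 → E3}
    (hn : AEStronglyMeasurable n μ) (hn1 : ∀ᵐ x ∂μ, ‖n x‖ = 1) (c : Coef M) :
    MemLp (fun x => toC3 (n x) ⨯₃ field M c x) 2 μ := by
  obtain ⟨C, hC⟩ := exists_bound_field c
  refine MemLp.of_bound ?_ (2 * (‖toC3L‖ * 1) * C) ?_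
  · have h1 : AEStronglyMeasurable (fun x => toC3 (n x)) μ :=
      continuous_toC3.comp_aestronglyMeasurable hn
    have h2 : AEStronglyMeasurable (field M c) μ := (measurable_field c).aestronglyMeasurable
    exact aestronglyMeasurable_cross h1 h2
  · filter_upwards [hn1] with x hx
    refine (norm_cross_le _ _).trans ?_
    have h1 : ‖toC3 (n x)‖ ≤ ‖toC3L‖ * 1 := by
      rw [← hx, ← toC3L_apply]; exact toC3L.le_opNorm _
    gcongr
    exact hC x

theorem normSq3_eq (z : C3) : normSq3 z = ‖(WithLp.toLp 2 z : EuclideanSpace ℂ (Fin 3))‖ ^ 2 := by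
  rw [EuclideanSpace.norm_sq_eq]; rfl

theorem memLp_toLp {X : Type*} [MeasurableSpace X] {μ : Measure X} {f : X → C3} (hf : MemLp f 2 μ) :
    MemLp (fun x => (WithLp.toLp 2 (f x) : EuclideanSpace ℂ (Fin 3))) 2 μ :=
  ((PiLp.continuousLinearEquiv 2 ℂ fun _ : Fin 3 => ℂ).symm.toContinuousLinearMap).comp_memLp' hf

end Multipliers

section CurlFree

variable {M : TetMesh} {Γ : Set E3}

/-! ### Weakly curl free fields -/

theorem integral_pd_eq_zero {φ : E3 → ℂ} (hφ : ContDiff ℝ (⊤ : ℕ∞) φ) (hc : HasCompactSupport φ)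
    (j : Fin 3) : ∫ x, pd j φ x = 0 := by
  have hi : Integrable (pd j φ) volume :=
    (contDiff_pd hφ j).continuous.integrable_of_hasCompactSupport (hasCompactSupport_pd hc j)
  have hi' : Integrable φ volume := hφ.continuous.integrable_of_hasCompactSupport hc
  have := integral_mul_fderiv_eq_neg_fderiv_mul_of_integrable (𝕜 := ℂ) (μ := volume)
    (f := fun _ : E3 => (1 : ℂ)) (g := φ) (v := EuclideanSpace.single j (1 : ℝ))
    (by simp) (by simpa using! hi) (by simpa using hi')
    (fun x _ => differentiableAt_const _) (fun x _ => (hφ.differentiable (by simp)) x)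
  simpa [pd] using this

/-- Constant fields are weakly curl free. -/
theorem integral_const_dot_curl {w : E3 → C3} (hw : ContDiff ℝ (⊤ : ℕ∞) w)
    (hc : HasCompactSupport w) (a : C3) : ∫ x, a ⬝ᵥ curl w x = 0 := by
  have hi : ∀ i j, Integrable (pd j fun y => w y i) volume := fun i j =>
    (contDiff_pd (contDiff_component hw i) j).continuous.integrable_of_hasCompactSupport
      (hasCompactSupport_pd (hasCompactSupport_component hc i) j)
  have h0 : ∀ i j, ∫ x, pd j (fun y => w y i) x = 0 := fun i j =>
    integral_pd_eq_zero (contDiff_component hw i) (hasCompactSupport_component hc i) j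
  simp only [dotProduct, Fin.sum_univ_three, curl, Matrix.cons_val_zero, Matrix.cons_val_one,
    Matrix.cons_val]
  rw [integral_add, integral_add]
  · simp only [integral_const_mul]
    rw [integral_sub (hi _ _) (hi _ _), integral_sub (hi _ _) (hi _ _),
      integral_sub (hi _ _) (hi _ _)]
    simp [h0]
  all_goals first
    | exact ((hi _ _).sub (hi _ _)).const_mul _
    | exact (((hi _ _).sub (hi _ _)).const_mul _).add (((hi _ _).sub (hi _ _)).const_mul _)

/-- A scalar test function in one component is an admissible vector valued test function. -/
theorem single_test {g : E3 → ℝ} (hg : ContDiff ℝ (⊤ : ℕ∞) g) (hgc : HasCompactSupport g)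
    (i : Fin 3) :
    ContDiff ℝ (⊤ : ℕ∞) (fun x => (Pi.single i ((g x : ℝ) : ℂ) : C3)) ∧
      HasCompactSupport (fun x => (Pi.single i ((g x : ℝ) : ℂ) : C3)) ∧
      tsupport (fun x => (Pi.single i ((g x : ℝ) : ℂ) : C3)) ⊆ tsupport g := by
  have hsupp : tsupport (fun x => (Pi.single i ((g x : ℝ) : ℂ) : C3)) ⊆ tsupport g := by
    refine closure_mono fun x hx hgx => hx ?_
    simp [hgx]
  refine ⟨contDiff_pi.mpr fun k => ?_, hgc.of_isClosed_subset (isClosed_tsupport _) hsupp, hsupp⟩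
  by_cases hk : k = i
  · subst hk
    simp only [Pi.single_eq_same]
    exact Complex.ofRealCLM.contDiff.comp hg
  · simpa [hk] using contDiff_const

/-- If the elementwise curl of an edge element field vanishes, so does its distributional curl. -/
theorem integral_field_dot_curl_eq_zero {c : Coef M} (hc : MemHcurl M.Ω Γ (field M c))
    (hΓ : Γ ⊆ frontier M.Ω) (h0 : curlCoef M c = 0) {w : E3 → C3} (hw : ContDiff ℝ (⊤ : ℕ∞) w)
    (hwc : HasCompactSupport w) (hws : tsupport w ⊆ M.Ω) :
    ∫ x in M.Ω, field M c x ⬝ᵥ curl w x = 0 := by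
  have hb : ∀ K, (c K).2 = 0 := by
    intro K
    have := congrFun h0 K
    rw [curlCoef_apply] at this
    simpa using (Prod.ext_iff.mp this).1
  obtain ⟨-, v, hv, H⟩ := hc
  have hdisj : ∀ w : E3 → C3, tsupport w ⊆ M.Ω → Disjoint (tsupport w) (closure Γ) := by
    intro w hws
    refine Disjoint.mono hws (closure_minimal hΓ isClosed_frontier) ?_
    rw [TetMesh.isOpen_Ω.frontier_eq]
    exact disjoint_sdiff_right
  have hvint : Integrable v (volume.restrict M.Ω) := hv.integrable (by norm_num)
  -- the weak curl vanishes in every core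
  have hv0 : ∀ K : M.elements, ∀ i, ∀ᵐ x : E3, x ∈ M.core K → v x i = 0 := by
    intro K i
    have hint : IntegrableOn (fun x => v x i) M.Ω volume := by
      exact (ContinuousLinearMap.proj (R := ℂ) (φ := fun _ : Fin 3 => ℂ) i).integrable_comp hvint
    refine (M.isOpen_core K).ae_eq_zero_of_integral_contDiff_smul_eq_zero
      (hint.mono_set (TetMesh.core_subset_Ω K.2)).locallyIntegrableOn fun g hg hgc hgs => ?_
    set W : E3 → C3 := fun x => Pi.single i ((g x : ℝ) : ℂ) with hW
    obtain ⟨hWd, hWc, hWsupp⟩ : ContDiff ℝ (⊤ : ℕ∞) W ∧ HasCompactSupport W ∧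
      tsupport W ⊆ tsupport g := single_test hg hgc i
    have hWs : tsupport W ⊆ M.core K := hWsupp.trans hgs
    have e1 := H W hWd hWc (hdisj W (hWs.trans (TetMesh.core_subset_Ω K.2)))
    have e2 : ∫ x in M.Ω, field M c x ⬝ᵥ curl W x = 0 := by
      rw [setIntegral_eq_integral_of_forall_compl_eq_zero,
        ← integral_const_dot_curl hWd hWc (c K).1]
      · congr 1
        ext x
        by_cases hx : x ∈ M.core K
        · rw [field_of_mem_core c K hx, hb K]; simp
        · rw [curl_eq_zero_of_notMem_tsupport fun h => hx (hWs h)]; simp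
      · intro x hx
        rw [curl_eq_zero_of_notMem_tsupport fun h => hx (TetMesh.core_subset_Ω K.2 (hWs h))]; simp
    rw [e2] at e1
    rw [e1, setIntegral_eq_integral_of_forall_compl_eq_zero]
    · congr 1; ext x
      simp [hW, mul_comm]
    · intro x hx
      have : g x = 0 := by
        by_contra hgx
        exact hx (TetMesh.core_subset_Ω K.2 (hgs (subset_tsupport g hgx)))
      simp [hW, this]
  rw [H w hw hwc (hdisj w hws)]
  have : ∀ᵐ x : E3, ∀ K : M.elements, ∀ i, x ∈ M.core K → v x i = 0 :=
    ae_all_iff.mpr fun K => ae_all_iff.mpr fun i => hv0 K i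
  refine integral_eq_zero_of_ae ?_
  filter_upwards [M.ae_Ω, ae_restrict_of_ae this] with x ⟨K, hK, hx⟩ hall
  have : v x = 0 := by ext i; exact hall ⟨K, hK⟩ i hx
  simp [this]

/-! ### Mollification and potentials -/

/-- Componentwise mollification of `F` by the normalised bump function `φ`. -/
def mollify (φ : ContDiffBump (0 : E3)) (F : E3 → C3) (x : E3) : C3 :=
  fun i => (φ.normed volume ⋆[ContinuousLinearMap.lsmul ℝ ℝ, volume] fun y => F y i) x

/-- The set of points whose distance to the complement of `D` exceeds `δ`. -/
def erosion (D : Set E3) (δ : ℝ) : Set E3 := {x | ∃ r > δ, Metric.ball x r ⊆ D}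

theorem isOpen_erosion (D : Set E3) (δ : ℝ) : IsOpen (erosion D δ) := by
  rw [Metric.isOpen_iff]
  rintro x ⟨r, hr, hx⟩
  refine ⟨(r - δ) / 2, by linarith, fun y hy => ⟨(r + δ) / 2, by linarith, fun z hz => hx ?_⟩⟩
  rw [Metric.mem_ball] at *
  linarith [dist_triangle z y x]

theorem convex_erosion {D : Set E3} (hD : Convex ℝ D) (δ : ℝ) : Convex ℝ (erosion D δ) := by
  rintro x ⟨r, hr, hx⟩ y ⟨s, hs, hy⟩ a b ha hb hab
  refine ⟨min r s, lt_min hr hs, fun z hz => ?_⟩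
  rw [Metric.mem_ball, dist_eq_norm] at hz
  have h1 : x + (z - (a • x + b • y)) ∈ D := hx (by
    rw [Metric.mem_ball, dist_eq_norm, add_sub_cancel_left]; exact hz.trans_le (min_le_left _ _))
  have h2 : y + (z - (a • x + b • y)) ∈ D := hy (by
    rw [Metric.mem_ball, dist_eq_norm, add_sub_cancel_left]; exact hz.trans_le (min_le_right _ _))
  have := hD h1 h2 ha hb hab
  convert this using 1
  have hb' : b = 1 - a := by linarith
  subst hb'
  module

theorem erosion_subset {D : Set E3} {δ : ℝ} (hδ : 0 ≤ δ) : erosion D δ ⊆ D := by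
  rintro x ⟨r, hr, hx⟩
  exact hx (Metric.mem_ball_self (hδ.trans_lt hr))

variable {D : Set E3} {F : E3 → C3}

theorem contDiff_mollify (φ : ContDiffBump (0 : E3))
    (hF : ∀ i, LocallyIntegrable (fun y => F y i) volume) (i : Fin 3) :
    ContDiff ℝ (⊤ : ℕ∞) fun x => mollify φ F x i :=
  φ.hasCompactSupport_normed.contDiff_convolution_left _ φ.contDiff_normed (hF i)

theorem pd_mollify (φ : ContDiffBump (0 : E3))
    (hF : ∀ i, LocallyIntegrable (fun y => F y i) volume) (i j : Fin 3) (x : E3) :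
    pd j (fun y => mollify φ F y i) x =
      ∫ y, ((fderiv ℝ (φ.normed volume) (x - y) (EuclideanSpace.single j (1 : ℝ)) : ℝ) : ℂ) *
        F y i := by
  have h := (φ.hasCompactSupport_normed (μ := volume)).hasFDerivAt_convolution_left
    (ContinuousLinearMap.lsmul ℝ ℝ) φ.contDiff_normed (hF i) x
  have hex : ConvolutionExistsAt (fderiv ℝ (φ.normed volume)) (fun y => F y i) x
      ((ContinuousLinearMap.lsmul ℝ ℝ : ℝ →L[ℝ] ℂ →L[ℝ] ℂ).precompL E3) volume := by
    refine HasCompactSupport.convolutionExists_left _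
      ((φ.hasCompactSupport_normed (μ := volume)).fderiv ℝ) ?_ (hF i) x
    exact (φ.contDiff_normed (n := 1)).continuous_fderiv (by norm_num)
  rw [pd]
  change fderiv ℝ (φ.normed volume ⋆[ContinuousLinearMap.lsmul ℝ ℝ, volume] fun y => F y i) x _ = _
  rw [h.fderiv, convolution_eq_swap, ContinuousLinearMap.integral_apply hex.integrable_swap]
  congr 1

/-- The Jacobian of a mollified weakly curl free field is symmetric: translated mollifiers are
test functions as long as the point stays away from the boundary. -/
theorem pd_mollify_symm (hF : ∀ i, LocallyIntegrable (fun y => F y i) volume)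
    (hcurl : ∀ w : E3 → C3, ContDiff ℝ (⊤ : ℕ∞) w → HasCompactSupport w → tsupport w ⊆ D →
      ∫ x in D, F x ⬝ᵥ curl w x = 0)
    {φ : ContDiffBump (0 : E3)} {δ : ℝ} (hφ : φ.rOut ≤ δ) {x : E3} (hx : x ∈ erosion D δ)
    (i j : Fin 3) :
    pd j (fun y => mollify φ F y i) x = pd i (fun y => mollify φ F y j) x := by
  -- the reflected mollifier, whose derivatives in `y` are minus those of the mollifier
  set g : E3 → ℝ := fun y => φ.normed volume (x - y) with hg
  have hgd : ContDiff ℝ (⊤ : ℕ∞) g := φ.contDiff_normed.comp (contDiff_const.sub contDiff_id)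
  have hgsupp : tsupport g ⊆ Metric.closedBall x φ.rOut := by
    refine closure_minimal (fun y hy => ?_) Metric.isClosed_closedBall
    have h1 : x - y ∈ Function.support (φ.normed volume) := hy
    rw [φ.support_normed_eq, mem_ball_zero_iff] at h1
    rw [Metric.mem_closedBall, dist_eq_norm, norm_sub_rev]
    exact h1.le
  have hgc : HasCompactSupport g :=
    (isCompact_closedBall x φ.rOut).of_isClosed_subset (isClosed_tsupport g) hgsupp
  have hgD : tsupport g ⊆ D := by
    obtain ⟨r, hr, hxr⟩ := hx
    exact hgsupp.trans ((Metric.closedBall_subset_ball (hφ.trans_lt hr)).trans hxr)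
  set G : E3 → ℂ := fun y => ((g y : ℝ) : ℂ) with hG
  have hGd : ContDiff ℝ (⊤ : ℕ∞) G := Complex.ofRealCLM.contDiff.comp hgd
  have hGc : HasCompactSupport G := hgc.comp_left (g := fun r : ℝ => (r : ℂ)) rfl
  have hpdG : ∀ j y, pd j G y =
      -((fderiv ℝ (φ.normed volume) (x - y) (EuclideanSpace.single j (1 : ℝ)) : ℝ) : ℂ) := by
    intro j y
    have h1 : HasFDerivAt (φ.normed volume) (fderiv ℝ (φ.normed volume) (x - y)) (x - y) :=
      ((φ.contDiff_normed (n := 1)).differentiable (by norm_num) _).hasFDerivAt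
    have h2 : HasFDerivAt (fun y : E3 => x - y) (-(ContinuousLinearMap.id ℝ E3)) y :=
      (hasFDerivAt_id y).const_sub x
    have h3 : HasFDerivAt G (Complex.ofRealCLM.comp
        ((fderiv ℝ (φ.normed volume) (x - y)).comp (-(ContinuousLinearMap.id ℝ E3)))) y :=
      Complex.ofRealCLM.hasFDerivAt.comp y (h1.comp y h2)
    rw [pd, h3.fderiv]
    simp
  have hmol : ∀ i j, pd j (fun y => mollify φ F y i) x = -∫ y, pd j G y * F y i := by
    intro i j
    rw [pd_mollify φ hF, ← integral_neg]
    congr 1; ext y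
    rw [hpdG]; ring
  have hint : ∀ i j, Integrable (fun y => pd j G y * F y i) volume := fun i j =>
    (hF i).integrable_smul_left_of_hasCompactSupport (contDiff_pd hGd j).continuous
      (hasCompactSupport_pd hGc j)
  have hpd0 : ∀ (j : Fin 3) (x : E3), pd j (fun _ => (0 : ℂ)) x = 0 := fun j x => by
    simp [pd]
  have htest : ∀ k, ∫ y, F y ⬝ᵥ curl (fun x => Pi.single k (G x)) y = 0 := by
    intro k
    obtain ⟨h1, h2, h3⟩ := single_test hgd hgc k
    rw [← hcurl _ h1 h2 (h3.trans hgD), setIntegral_eq_integral_of_forall_compl_eq_zero]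
    intro y hy
    rw [curl_eq_zero_of_notMem_tsupport fun h => hy (hgD (h3 h))]; simp
  have e0 : ∫ y, pd 2 G y * F y 1 = ∫ y, pd 1 G y * F y 2 := by
    rw [← sub_eq_zero, ← integral_sub (hint _ _) (hint _ _), ← htest 0]
    congr 1; ext y
    simp [dotProduct, Fin.sum_univ_three, curl, hpd0]; ring
  have e1 : ∫ y, pd 0 G y * F y 2 = ∫ y, pd 2 G y * F y 0 := by
    rw [← sub_eq_zero, ← integral_sub (hint _ _) (hint _ _), ← htest 1]
    congr 1; ext y
    simp [dotProduct, Fin.sum_univ_three, curl, hpd0]; ring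
  have e2 : ∫ y, pd 1 G y * F y 0 = ∫ y, pd 0 G y * F y 1 := by
    rw [← sub_eq_zero, ← integral_sub (hint _ _) (hint _ _), ← htest 2]
    congr 1; ext y
    simp [dotProduct, Fin.sum_univ_three, curl, hpd0]; ring
  rw [hmol, hmol]
  fin_cases i <;> fin_cases j <;> simp [e0, e1, e2]

/-- The real linear functional `x ↦ a · x`. -/
def dotL : C3 →L[ℝ] (E3 →L[ℝ] ℂ) :=
  LinearMap.toContinuousLinearMap
    { toFun := fun a => ((dotProductBilin ℂ ℂ a).toContinuousLinearMap.restrictScalars ℝ).comp toC3L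
      map_add' := fun a b => by ext x; simp
      map_smul' := fun r a => by ext x; simp }

theorem dotL_apply (a : C3) (x : E3) : dotL a x = a ⬝ᵥ toC3 x := rfl

theorem fderiv_eq_sum_pd {m : E3 → C3} {x : E3} (hm : DifferentiableAt ℝ m x) (u : E3) (i : Fin 3) :
    fderiv ℝ m x u i = ∑ j, pd j (fun y => m y i) x * ((u j : ℝ) : ℂ) := by
  have h1 : HasFDerivAt (fun y => m y i)
      ((ContinuousLinearMap.proj (R := ℝ) (φ := fun _ : Fin 3 => ℂ) i).comp (fderiv ℝ m x)) x :=
    (ContinuousLinearMap.proj (R := ℝ) (φ := fun _ : Fin 3 => ℂ) i).hasFDerivAt.comp x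
      hm.hasFDerivAt
  have h2 : u = ∑ j, u j • EuclideanSpace.single j (1 : ℝ) := by
    ext k
    simp [Finset.sum_apply, Pi.single_apply]
  conv_lhs => rw [h2]
  simp only [pd, h1.fderiv, map_sum, map_smul, Finset.sum_apply, Pi.smul_apply,
    ContinuousLinearMap.comp_apply, ContinuousLinearMap.proj_apply, Complex.real_smul]
  exact Finset.sum_congr rfl fun j _ => mul_comm _ _

/-- The Poincaré lemma for the mollified field on the convex set `erosion D δ`. -/
theorem exists_potential (hD : Convex ℝ D) (hF : ∀ i, LocallyIntegrable (fun y => F y i) volume)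
    (hcurl : ∀ w : E3 → C3, ContDiff ℝ (⊤ : ℕ∞) w → HasCompactSupport w → tsupport w ⊆ D →
      ∫ x in D, F x ⬝ᵥ curl w x = 0)
    {φ : ContDiffBump (0 : E3)} {δ : ℝ} (hφ : φ.rOut ≤ δ) :
    ∃ f : E3 → ℂ, ContDiffOn ℝ (⊤ : ℕ∞) f (erosion D δ) ∧
      ∀ x ∈ erosion D δ, grad f x = mollify φ F x := by
  have hm : ContDiff ℝ (⊤ : ℕ∞) (mollify φ F) := contDiff_pi.mpr fun i => contDiff_mollify φ hF i
  have hmd : Differentiable ℝ (mollify φ F) := hm.differentiable (by simp)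
  have hω : ContDiff ℝ (⊤ : ℕ∞) fun x => dotL (mollify φ F x) := dotL.contDiff.comp hm
  have hfd : ∀ a, fderiv ℝ (fun x => dotL (mollify φ F x)) a =
      dotL.comp (fderiv ℝ (mollify φ F) a) := fun a =>
    (dotL.hasFDerivAt.comp a (hmd a).hasFDerivAt).fderiv
  obtain ⟨f, hf⟩ := (convex_erosion hD δ).exists_forall_hasFDerivAt_of_fderiv_symmetric
    (isOpen_erosion D δ) (hω.differentiable (by simp)).differentiableOn (fun a ha u v => by
      rw [hfd, ContinuousLinearMap.comp_apply, ContinuousLinearMap.comp_apply, dotL_apply,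
        dotL_apply]
      have hs := fun i j => pd_mollify_symm hF hcurl hφ ha i j
      simp only [dotProduct, fderiv_eq_sum_pd (hmd a), Finset.sum_mul, toC3]
      rw [Finset.sum_comm]
      refine Finset.sum_congr rfl fun i _ => Finset.sum_congr rfl fun j _ => ?_
      rw [hs]; ring)
  refine ⟨f, ?_, fun x hx => ?_⟩
  · refine (contDiffOn_infty_iff_fderiv_of_isOpen (isOpen_erosion D δ)).mpr
      ⟨fun x hx => (hf x hx).differentiableAt.differentiableWithinAt, ?_⟩
    exact hω.contDiffOn.congr fun x hx => (hf x hx).fderiv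
  · ext j
    rw [grad, pd, (hf x hx).fderiv, dotL_apply, toC3_single]
    simp

theorem pd_conj {f : E3 → ℂ} (j : Fin 3) (x : E3) :
    pd j (fun y => (starRingEnd ℂ) (f y)) x = (starRingEnd ℂ) (pd j f x) := by
  have := Complex.conjCLE.comp_fderiv (f := f) (x := x)
  rw [pd, pd]
  change fderiv ℝ (Complex.conjCLE ∘ f) x _ = _
  rw [this]
  simp

/-- A divergence free field is orthogonal to mollified curl free fields. -/
theorem integral_source_mollify_eq_zero (hD : Convex ℝ D)
    (hF : ∀ i, LocallyIntegrable (fun y => F y i) volume)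
    (hcurl : ∀ w : E3 → C3, ContDiff ℝ (⊤ : ℕ∞) w → HasCompactSupport w → tsupport w ⊆ D →
      ∫ x in D, F x ⬝ᵥ curl w x = 0)
    {φ : ContDiffBump (0 : E3)} {δ : ℝ} (hφ : φ.rOut ≤ δ) {J : E3 → C3} (hJc : HasCompactSupport J)
    (hJs : tsupport J ⊆ erosion D δ)
    (hJ : ∀ ψ : E3 → ℂ, ContDiff ℝ (⊤ : ℕ∞) ψ → HasCompactSupport ψ → tsupport ψ ⊆ D →
      ∫ x in D, J x ⬝ᵥ grad ψ x = 0) :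
    ∫ x in D, J x ⬝ᵥ star (mollify φ F x) = 0 := by
  have hδ : 0 ≤ δ := φ.rOut_pos.le.trans hφ
  obtain ⟨f, hf, hgrad⟩ := exists_potential hD hF hcurl hφ
  obtain ⟨t, ht, hJt, htO⟩ := exists_compact_between hJc (isOpen_erosion D δ) hJs
  obtain ⟨χ, hχ1, hχ0, -⟩ := exists_contMDiffMap_one_nhds_of_subset_interior (n := (⊤ : ℕ∞))
    (modelWithCornersSelf ℝ E3) (isClosed_tsupport J) hJt
  have hχd : ContDiff ℝ (⊤ : ℕ∞) χ := χ.contMDiff.contDiff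
  -- near the support of `J` the gradient of this test function is the conjugate mollified field
  set ψ : E3 → ℂ := fun x => ((χ x : ℝ) : ℂ) * (starRingEnd ℂ) (f x) with hψ
  have hψ0 : ∀ x ∉ t, ψ x = 0 := fun x hx => by simp [hψ, hχ0 x hx]
  have hψs : tsupport ψ ⊆ t := by
    refine closure_minimal (fun x hx => ?_) ht.isClosed
    by_contra hxt
    exact hx (hψ0 x hxt)
  have hψd : ContDiff ℝ (⊤ : ℕ∞) ψ := by
    rw [contDiff_iff_contDiffAt]
    intro x
    by_cases hx : x ∈ erosion D δ
    · have h1 : ContDiffAt ℝ (⊤ : ℕ∞) (fun x => ((χ x : ℝ) : ℂ)) x :=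
        (Complex.ofRealCLM.contDiff.comp hχd).contDiffAt
      have h2 : ContDiffAt ℝ (⊤ : ℕ∞) (fun x => (starRingEnd ℂ) (f x)) x :=
        Complex.conjCLE.contDiff.contDiffAt.comp x
          (hf.contDiffAt ((isOpen_erosion D δ).mem_nhds hx))
      exact h1.mul h2
    · have h3 : ψ =ᶠ[𝓝 x] fun _ => 0 := by
        filter_upwards [ht.isClosed.isOpen_compl.mem_nhds fun h => hx (htO h)] with y hy
        exact hψ0 y hy
      exact contDiffAt_const.congr_of_eventuallyEq h3
  rw [← hJ ψ hψd (ht.of_isClosed_subset (isClosed_tsupport ψ) hψs)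
    (hψs.trans (htO.trans (erosion_subset hδ)))]
  congr 1; ext x
  by_cases hx : x ∈ tsupport J
  · have h4 : ψ =ᶠ[𝓝 x] fun y => (starRingEnd ℂ) (f y) := by
      filter_upwards [hχ1.filter_mono (nhds_le_nhdsSet hx)] with y hy
      simp [hψ, hy]
    have h5 : grad ψ x = star (mollify φ F x) := by
      rw [← hgrad x (hJs hx)]
      ext j
      rw [grad, pd, h4.fderiv_eq]
      exact pd_conj j x
    rw [h5]
  · rw [image_eq_zero_of_notMem_tsupport hx]; simp

theorem norm_mollify_le (φ : ContDiffBump (0 : E3)) {C : ℝ} (hC : ∀ x, ‖F x‖ ≤ C) (x : E3) :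
    ‖mollify φ F x‖ ≤ C := by
  have hC0 : 0 ≤ C := (norm_nonneg _).trans (hC 0)
  rw [pi_norm_le_iff_of_nonneg hC0]
  intro i
  have hnn : ∀ t, 0 ≤ φ.normed volume t := φ.nonneg_normed
  calc ‖mollify φ F x i‖ ≤ ∫ t, φ.normed volume t * C := by
        refine norm_integral_le_of_norm_le (φ.integrable_normed.mul_const C)
          (Eventually.of_forall fun t => ?_)
        rw [ContinuousLinearMap.lsmul_apply, norm_smul, Real.norm_of_nonneg (hnn t)]
        exact mul_le_mul_of_nonneg_left ((norm_le_pi_norm _ i).trans (hC _)) (hnn t)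
    _ = C := by rw [integral_mul_const, φ.integral_normed, one_mul]

/-- A divergence free field with compact support in a convex domain is orthogonal to bounded weakly
curl free fields. -/
theorem integral_source_eq_zero (hD : Convex ℝ D) (hDo : IsOpen D)
    [IsFiniteMeasure (volume.restrict D)]
    (hF : ∀ i, LocallyIntegrable (fun y => F y i) volume) {C : ℝ} (hC : ∀ x, ‖F x‖ ≤ C)
    (hcurl : ∀ w : E3 → C3, ContDiff ℝ (⊤ : ℕ∞) w → HasCompactSupport w → tsupport w ⊆ D →
      ∫ x in D, F x ⬝ᵥ curl w x = 0) {J : E3 → C3} (hJ2 : MemLp J 2 volume)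
    (hJc : HasCompactSupport J) (hJs : tsupport J ⊆ D)
    (hJ : ∀ ψ : E3 → ℂ, ContDiff ℝ (⊤ : ℕ∞) ψ → HasCompactSupport ψ → tsupport ψ ⊆ D →
      ∫ x in D, J x ⬝ᵥ grad ψ x = 0) :
    ∫ x in D, J x ⬝ᵥ star (F x) = 0 := by
  obtain ⟨r, hr, hrD⟩ := hJc.exists_thickening_subset_open hDo hJs
  have hJr : tsupport J ⊆ erosion D (r / 2) := fun x hx =>
    ⟨r, by linarith, (Metric.ball_subset_thickening hx r).trans hrD⟩
  -- the radii stay in a fixed ratio, as almost everywhere convergence of mollifications requires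
  let φ : ℕ → ContDiffBump (0 : E3) := fun k =>
    { rIn := r / 2 / (k + 1) / 2
      rOut := r / 2 / (k + 1)
      rIn_pos := by positivity
      rIn_lt_rOut := half_lt_self (by positivity) }
  have hφ : ∀ k, (φ k).rOut ≤ r / 2 := fun k =>
    div_le_self (by positivity) (by linarith [(Nat.cast_nonneg k : (0 : ℝ) ≤ k)])
  have hφ0 : Tendsto (fun k => (φ k).rOut) atTop (𝓝 0) := by
    have := tendsto_one_div_add_atTop_nhds_zero_nat.const_mul (r / 2)
    rw [mul_zero] at this
    exact this.congr fun k => by simp [φ, div_eq_mul_inv]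
  have hae : ∀ᵐ x : E3, ∀ i, Tendsto (fun k => mollify (φ k) F x i) atTop (𝓝 (F x i)) := by
    rw [ae_all_iff]
    intro i
    refine ContDiffBump.ae_convolution_tendsto_right_of_locallyIntegrable (K := 2) hφ0
      (Eventually.of_forall fun k => ?_) (hF i)
    change r / 2 / (k + 1) ≤ 2 * (r / 2 / (k + 1) / 2)
    linarith
  have hJi : Integrable J (volume.restrict D) := (hJ2.restrict D).integrable (by norm_num)
  have hlim : Tendsto (fun k => ∫ x in D, J x ⬝ᵥ star (mollify (φ k) F x)) atTop
      (𝓝 (∫ x in D, J x ⬝ᵥ star (F x))) := by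
    refine tendsto_integral_of_dominated_convergence (fun x => 3 * (‖J x‖ * C)) (fun k => ?_)
      ((hJi.norm.mul_const C).const_mul 3) (fun k => Eventually.of_forall fun x => ?_) ?_
    · have hmc : Continuous (mollify (φ k) F) :=
        continuous_pi fun i => (contDiff_mollify (φ k) hF i).continuous
      have hJm := hJi.aestronglyMeasurable
      simp only [dotProduct]
      refine Finset.aestronglyMeasurable_fun_sum _ fun i _ => ?_
      exact ((continuous_apply i).comp_aestronglyMeasurable hJm).mul
        (Continuous.aestronglyMeasurable (by fun_prop))
    · rw [dotProduct]
      refine (norm_sum_le _ _).trans ?_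
      have : ∀ i ∈ (Finset.univ : Finset (Fin 3)),
          ‖J x i * star (mollify (φ k) F x) i‖ ≤ ‖J x‖ * C := by
        intro i _
        rw [norm_mul]
        gcongr
        · exact norm_le_pi_norm _ _
        · rw [Pi.star_apply, norm_star]
          exact (norm_le_pi_norm _ _).trans (norm_mollify_le _ hC x)
      refine (Finset.sum_le_sum this).trans_eq ?_
      simp
    · filter_upwards [ae_restrict_of_ae hae] with x hx
      simp only [dotProduct]
      refine tendsto_finsetSum _ fun i _ => Tendsto.const_mul _ ?_
      exact (continuous_star.tendsto _).comp (hx i)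
  have h0 : ∀ k, ∫ x in D, J x ⬝ᵥ star (mollify (φ k) F x) = 0 := fun k =>
    integral_source_mollify_eq_zero hD hF hcurl (hφ k) hJc hJr hJ
  simp only [h0] at hlim
  exact (tendsto_nhds_unique hlim tendsto_const_nhds)

/-- Compatibility of the load: the source is orthogonal to the curl free edge element fields. -/
theorem integral_source_field_eq_zero (hconv : Convex ℝ M.Ω) (hΓ : Γ ⊆ frontier M.Ω)
    {P : Coefficients} (hP : P.Admissible M) {c : Coef M} (hc : c ∈ edgeCoef M Γ)
    (h0 : curlCoef M c = 0) : ∫ x in M.Ω, P.J x ⬝ᵥ star (field M c x) = 0 := by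
  obtain ⟨C, hC⟩ := exists_bound_field c
  refine integral_source_eq_zero hconv TetMesh.isOpen_Ω (fun i => ?_) hC
    (fun w hw hwc hws => integral_field_dot_curl_eq_zero hc hΓ h0 hw hwc hws) hP.J_memLp
    hP.J_compact (hP.J_support.trans TetMesh.Ω₀_subset_Ω) hP.J_div
  rw [locallyIntegrable_iff]
  intro k hk
  have : IsFiniteMeasure (volume.restrict k) := ⟨by simpa using hk.measure_lt_top⟩
  exact (memLp_component (memLp_field c (volume.restrict k) 2) i).integrable (by norm_num)

end CurlFree

section Problem

variable {M : TetMesh} {Γ : Set E3} {P : Coefficients}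

/-! ### The data -/

theorem isBoundedWeight_ε (hP : P.Admissible M) : IsBoundedWeight M.Ω₀ P.ε := by
  obtain ⟨m, hm, m', h⟩ := hP.ε_bounds
  refine ⟨hP.ε_meas.aestronglyMeasurable, m', ?_⟩
  rw [ae_restrict_iff' TetMesh.isOpen_Ω₀.measurableSet]
  refine Eventually.of_forall fun x hx => ?_
  rw [abs_of_pos (hm.trans_le (h x hx).1)]
  exact (h x hx).2

theorem isBoundedWeight_μ (hP : P.Admissible M) : IsBoundedWeight M.Ω (fun x => (P.μ x)⁻¹) := by
  obtain ⟨m, hm, m', h⟩ := hP.μ_bounds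
  refine ⟨hP.μ_meas.inv.aestronglyMeasurable, m⁻¹, ?_⟩
  rw [ae_restrict_iff' TetMesh.isOpen_Ω.measurableSet]
  refine Eventually.of_forall fun x hx => ?_
  have h0 := hm.trans_le (h x hx).1
  rw [abs_of_pos (inv_pos.mpr h0)]
  exact inv_anti₀ hm (h x hx).1

theorem μ_inv_pos (hP : P.Admissible M) : ∀ᵐ x ∂(volume.restrict M.Ω), 0 < (P.μ x)⁻¹ := by
  obtain ⟨m, hm, m', h⟩ := hP.μ_bounds
  rw [ae_restrict_iff' TetMesh.isOpen_Ω.measurableSet]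
  exact Eventually.of_forall fun x hx => inv_pos.mpr (hm.trans_le (h x hx).1)

/-- The form `a_h` on coefficients. -/
def coefForm (M : TetMesh) (P : Coefficients) (σ : E3 → ℝ) (c d : Coef M) : ℂ :=
  wform M.Ω (fun x => (P.μ x)⁻¹) (field M (curlCoef M c)) (field M (curlCoef M d))
    - Complex.I * (P.ω : ℂ) * wform M.Ωc (fun x => P.σ₀ + σ x) (field M c) (field M d)

theorem formA_field (σ : E3 → ℝ) (c d : Coef M) :
    formA M P σ (field M c) (field M d) = coefForm M P σ c d := by
  rw [coefForm, ← wform_congr (curl_field_ae c) (curl_field_ae d)]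
  rfl

/-- The load functional on coefficients. -/
def coefLoad (M : TetMesh) (P : Coefficients) (c : Coef M) : ℂ :=
  Complex.I * (P.ω : ℂ) * ∫ x in M.Ω, P.J x ⬝ᵥ star (field M c x)

theorem coefLoad_add (hP : P.Admissible M) (c d : Coef M) :
    coefLoad M P (c + d) = coefLoad M P c + coefLoad M P d := by
  have hJ : MemLp P.J 2 (volume.restrict M.Ω) := hP.J_memLp.restrict M.Ω
  have h : ∀ c : Coef M, Integrable (fun x => P.J x ⬝ᵥ star (field M c x)) (volume.restrict M.Ω) :=
    fun c => integrable_dotProduct hJ (memLp_star (memLp_field c _ 2))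
  rw [coefLoad, coefLoad, coefLoad, ← mul_add, ← integral_add (h c) (h d)]
  simp only [map_add, Pi.add_apply, star_add, dotProduct_add]

theorem coefLoad_smul (r : ℂ) (c : Coef M) :
    coefLoad M P (r • c) = (starRingEnd ℂ) r * coefLoad M P c := by
  have : ∀ x, P.J x ⬝ᵥ star (field M (r • c) x) =
      (starRingEnd ℂ) r * (P.J x ⬝ᵥ star (field M c x)) := by
    intro x
    rw [map_smul, Pi.smul_apply, star_smul, dotProduct_smul]; rfl
  rw [coefLoad, coefLoad]
  simp only [this]
  rw [integral_const_mul]; ring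

theorem isBoundedWeight_total {σ : E3 → ℝ} (hσ : σ ∈ conductivitySpace M) :
    IsBoundedWeight M.Ωc (fun x => P.σ₀ + σ x) :=
  (isBoundedWeight_const M.Ωc P.σ₀).add (isBoundedWeight_of_conductivity hσ)

theorem coefForm_add_right (hP : P.Admissible M) {σ : E3 → ℝ} (hσ : σ ∈ conductivitySpace M)
    (c d d' : Coef M) : coefForm M P σ c (d + d') = coefForm M P σ c d + coefForm M P σ c d' := by
  simp only [coefForm, map_add]
  rw [wform_add_right (isBoundedWeight_μ hP) (memLp_field _ _ _) (memLp_field _ _ _)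
    (memLp_field _ _ _), wform_add_right (isBoundedWeight_total hσ) (memLp_field _ _ _)
    (memLp_field _ _ _) (memLp_field _ _ _)]
  ring

theorem coefForm_smul_right (σ : E3 → ℝ) (r : ℂ) (c d : Coef M) :
    coefForm M P σ c (r • d) = (starRingEnd ℂ) r * coefForm M P σ c d := by
  simp only [coefForm, map_smul, wform_smul_right]
  ring

/-! ### Elimination of the multiplier -/

/-- Riesz representation for a conjugate linear functional. -/
theorem exists_riesz {H : Type*} [NormedAddCommGroup H] [InnerProductSpace ℂ H]
    [FiniteDimensional ℂ H] (l : H → ℂ) (hadd : ∀ F F', l (F + F') = l F + l F')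
    (hsmul : ∀ (r : ℂ) F, l (r • F) = (starRingEnd ℂ) r * l F) : ∃ z, ∀ F, ⟪F, z⟫_ℂ = l F := by
  have : CompleteSpace H := FiniteDimensional.complete ℂ H
  let g : H →ₗ[ℂ] ℂ :=
    { toFun := fun F => (starRingEnd ℂ) (l F)
      map_add' := fun F F' => by rw [hadd, map_add]
      map_smul' := fun r F => by
        rw [hsmul, map_mul, Complex.conj_conj, RingHom.id_apply, smul_eq_mul] }
  refine ⟨(InnerProductSpace.toDual ℂ H).symm g.toContinuousLinearMap, fun F => ?_⟩
  rw [← inner_conj_symm, InnerProductSpace.toDual_symm_apply]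
  simp [g]

/-- Elimination of the multiplier. The edge element fields that satisfy the constraint are
parametrised by a Hilbert space, and on it the state problem is the single variational equation
`a_h(E, F) = i ω ∫ J · conj F`. A multiplier is recovered because a functional that vanishes on the
annihilator of the functionals `b(∇φ, ·)` is itself of this form. -/
theorem exists_constrained_space (M : TetMesh) (Γ : Set E3) {P : Coefficients}
    (hP : P.Admissible M) :
    ∃ (N : ℕ) (γ : EuclideanSpace ℂ (Fin N) →ₗ[ℂ] Coef M),
      (∀ e, γ e ∈ edgeCoef M Γ) ∧
      (∀ σ E φ, IsDiscreteState M Γ P σ E φ → ∃ e, field M (γ e) = E ∧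
        ∀ F, coefForm M P σ (γ e) (γ F) = coefLoad M P (γ F)) ∧
      ∀ σ ∈ conductivitySpace M, ∀ e,
        (∀ F, coefForm M P σ (γ e) (γ F) = coefLoad M P (γ F)) →
        ∃ φ, IsDiscreteState M Γ P σ (field M (γ e)) φ := by
  let N := Module.finrank ℂ (edgeCoef M Γ)
  let X := EuclideanSpace ℂ (Fin N)
  let κ : X ≃ₗ[ℂ] edgeCoef M Γ := LinearEquiv.ofFinrankEq _ _ (by simp [X, N])
  let ι : X →ₗ[ℂ] Coef M := (edgeCoef M Γ).subtype ∘ₗ κ.toLinearMap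
  have hι : ∀ F, ι F ∈ edgeCoef M Γ := fun F => (κ F).2
  have hι' : ∀ c ∈ edgeCoef M Γ, ∃ F, ι F = c := fun c hc =>
    ⟨κ.symm ⟨c, hc⟩, by simp [ι]⟩
  have hε := isBoundedWeight_ε hP
  have hm : ∀ c : Coef M, MemLp (field M c) 2 (volume.restrict M.Ω₀) := fun c => memLp_field c _ _
  -- the functionals `F ↦ b(∇φ, F)`
  let R : Submodule ℂ X :=
    { carrier := {z | ∃ d ∈ multCoef M Γ, ∀ F, ⟪F, z⟫_ℂ =
        wform M.Ω₀ P.ε (field M d) (field M (ι F))}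
      zero_mem' := ⟨0, zero_mem _, fun F => by
        rw [map_zero, inner_zero_right]; simp [wform]⟩
      add_mem' := by
        rintro z z' ⟨d, hd, h⟩ ⟨d', hd', h'⟩
        refine ⟨d + d', add_mem hd hd', fun F => ?_⟩
        rw [map_add, wform_add_left hε (hm _) (hm _) (hm _), inner_add_right, h, h']
      smul_mem' := by
        rintro r z ⟨d, hd, h⟩
        refine ⟨r • d, Submodule.smul_mem _ _ hd, fun F => ?_⟩
        rw [map_smul, wform_smul_left, inner_smul_right, h] }
  have hR : ∀ d ∈ multCoef M Γ, ∃ z ∈ R, ∀ F, ⟪F, z⟫_ℂ =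
      wform M.Ω₀ P.ε (field M d) (field M (ι F)) := by
    intro d hd
    obtain ⟨z, hz⟩ := exists_riesz (fun F => wform M.Ω₀ P.ε (field M d) (field M (ι F)))
      (fun F F' => by simp only [map_add]; exact wform_add_right hε (hm _) (hm _) (hm _))
      (fun r F => by simp only [map_smul]; exact wform_smul_right r)
    exact ⟨z, ⟨d, hd, hz⟩, hz⟩
  have hRo : ∀ F ∈ Rᗮ, ∀ d ∈ multCoef M Γ, wform M.Ω₀ P.ε (field M d) (field M (ι F)) = 0 := by
    intro F hF d hd
    obtain ⟨z, hz, h⟩ := hR d hd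
    rw [← h, ← inner_conj_symm, hF z hz, map_zero]
  let κ' : EuclideanSpace ℂ (Fin (Module.finrank ℂ Rᗮ)) ≃ₗ[ℂ] Rᗮ :=
    LinearEquiv.ofFinrankEq _ _ (by simp)
  refine ⟨_, ι ∘ₗ Rᗮ.subtype ∘ₗ κ'.toLinearMap, fun e => hι _, ?_, ?_⟩
  · intro σ E φ hst
    have hE := hst.E_mem
    rw [edgeSpace_eq] at hE
    obtain ⟨c, hc, rfl⟩ := hE
    obtain ⟨e, rfl⟩ := hι' c hc
    have he : e ∈ Rᗮ := by
      rintro z ⟨d, ⟨ψ, hψ, hψd⟩, h⟩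
      rw [← inner_conj_symm, h, ← wform_conj_symm, ← hst.constraint ψ hψ]
      exact wform_congr EventuallyEq.rfl hψd.symm
    refine ⟨κ'.symm ⟨e, he⟩, by simp, fun F => ?_⟩
    obtain ⟨d, hd, hdφ⟩ := exists_multCoef hst.φ_mem
    have h1 := hst.state (field M (ι (κ' F))) (by rw [edgeSpace_eq]; exact ⟨_, hι _, rfl⟩)
    have h2 : formB M P (grad φ) (field M (ι (κ' F))) = 0 := by
      rw [← hRo (κ' F) (κ' F).2 d hd]
      exact wform_congr hdφ EventuallyEq.rfl
    rw [h2, add_zero, formA_field] at h1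
    have h1' : coefForm M P σ (ι e) (ι (κ' F)) = coefLoad M P (ι (κ' F)) := h1
    simpa using h1'
  · intro σ hσ e₀ he₀
    obtain ⟨e, he'⟩ : ∃ e : Rᗮ, κ' e₀ = e := ⟨_, rfl⟩
    have he : ∀ F : Rᗮ, coefForm M P σ (ι e) (ι F) = coefLoad M P (ι F) := fun F => by
      have := he₀ (κ'.symm F)
      simpa [he'] using this
    have hιe : (ι ∘ₗ Rᗮ.subtype ∘ₗ κ'.toLinearMap) e₀ = ι e := by simp [he']
    rw [hιe]
    obtain ⟨z, hz⟩ := exists_riesz (fun F : X => coefLoad M P (ι F) - coefForm M P σ (ι e) (ι F))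
      (fun F F' => by
        simp only [map_add, coefLoad_add hP, coefForm_add_right hP hσ]; ring)
      (fun r F => by
        simp only [map_smul, coefLoad_smul, coefForm_smul_right]; ring)
    -- the residual of the state equation vanishes on `Rᗮ`, so it is one of the functionals in `R`
    have hzR : z ∈ R := by
      rw [← Submodule.orthogonal_orthogonal R]
      intro F hF
      rw [hz, sub_eq_zero]
      exact (he ⟨F, hF⟩).symm
    obtain ⟨d, ⟨φ, hφ, hφd⟩, hd⟩ := hzR
    refine ⟨φ, ⟨by rw [edgeSpace_eq]; exact ⟨_, hι _, rfl⟩, hφ, fun F hF => ?_, fun ψ hψ => ?_⟩⟩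
    · rw [edgeSpace_eq] at hF
      obtain ⟨c, hc, rfl⟩ := hF
      obtain ⟨F, rfl⟩ := hι' c hc
      have h1 : formB M P (grad φ) (field M (ι F)) = ⟪F, z⟫_ℂ := by
        rw [hd]; exact wform_congr hφd EventuallyEq.rfl
      rw [h1, hz]
      change formA M P σ (field M (ι e)) _ + _ = coefLoad M P (ι F)
      rw [formA_field]; ring
    · obtain ⟨d', hd', hψd⟩ := exists_multCoef hψ
      have h2 := hRo e e.2 d' hd'
      have h3 : formB M P (field M (ι e)) (grad ψ) =
          wform M.Ω₀ P.ε (field M (ι e)) (field M d') := wform_congr EventuallyEq.rfl hψd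
      change formB M P (field M (ι e)) (grad ψ) = 0
      rw [h3, wform_conj_symm, h2, map_zero]

/-! ### Conductivities near a given one -/

/-- Nonnegativity holds in all of space, since conductivities vanish outside `Ω_c`; in particular it
holds at the vertices on the boundary of `Ω_c`. -/
theorem total_conductivity_nonneg {σmin : ℝ} (hP : P.Admissible M) (h0 : 0 ≤ σmin) {σ : E3 → ℝ}
    (hσ : σ ∈ admissibleSet M P σmin) (x : E3) : 0 ≤ P.σ₀ + σ x := by
  by_cases hx : x ∈ M.Ωc
  · exact h0.trans (hσ.2 x hx)
  · rw [hσ.1.2.1 x hx, add_zero]; exact hP.σ₀_pos.le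

/-- Inequalities between weights are inequalities between operators. -/
theorem isPositive_sub_of_weights {H : Type*} [NormedAddCommGroup H] [InnerProductSpace ℂ H]
    {γ : H →ₗ[ℂ] Coef M} {D : Set E3} [IsFiniteMeasure (volume.restrict D)] {w w' : E3 → ℝ}
    (hw : IsBoundedWeight D w) (hw' : IsBoundedWeight D w') {A A' : H →L[ℂ] H}
    (hA : ∀ E F, ⟪F, A E⟫_ℂ = wform D w (field M (γ E)) (field M (γ F)))
    (hA' : ∀ E F, ⟪F, A' E⟫_ℂ = wform D w' (field M (γ E)) (field M (γ F))) {c : ℝ}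
    (hle : ∀ᵐ x ∂(volume.restrict D), c * w x ≤ w' x) : (A' - (c : ℂ) • A).IsPositive := by
  refine isPositive_of_wform (γ := γ) (D := D) (w := fun x => w' x + -c * w x) (fun E F => ?_) ?_
  · rw [wform_add_weight hw' (hw.const_mul (-c)) (memLp_field _ _ _) (memLp_field _ _ _),
      wform_const_mul_weight, sub_apply, inner_sub_right,
      smul_apply, inner_smul_right, hA, hA']
    push_cast; ring
  · filter_upwards [hle] with x hx
    linarith

section Parametrisation

variable {H : Type*} [NormedAddCommGroup H] [InnerProductSpace ℂ H]
  {V : Type*} [NormedAddCommGroup V] [NormedSpace ℝ V]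

theorem continuous_eval [FiniteDimensional ℝ V] (κ : V ≃ₗ[ℝ] condSubmodule M) (x : E3) :
    Continuous fun v : V => (κ v : E3 → ℝ) x :=
  LinearMap.continuous_of_finiteDimensional
    ((LinearMap.proj x ∘ₗ (condSubmodule M).subtype) ∘ₗ κ.toLinearMap)

theorem isClosed_admissible [FiniteDimensional ℝ V] (κ : V ≃ₗ[ℝ] condSubmodule M)
    (P : Coefficients) (σmin : ℝ) :
    IsClosed {v | (κ v : E3 → ℝ) ∈ admissibleSet M P σmin} := by
  have : {v | (κ v : E3 → ℝ) ∈ admissibleSet M P σmin} =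
      ⋂ x ∈ M.Ωc, {v : V | σmin ≤ P.σ₀ + (κ v : E3 → ℝ) x} := by
    ext v
    simp only [mem_iInter]
    exact ⟨fun h => h.2, fun h => ⟨(κ v).2, h⟩⟩
  rw [this]
  exact isClosed_biInter fun x _ =>
    isClosed_le continuous_const (continuous_const.add (continuous_eval κ x))

/-- The conductivity form depends affinely, hence continuously, on the conductivity. -/
theorem exists_conductivity_operators [FiniteDimensional ℂ H] [FiniteDimensional ℝ V]
    (γ : H →ₗ[ℂ] Coef M) (κ : V ≃ₗ[ℝ] condSubmodule M) (P : Coefficients) :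
    ∃ S : V → H →L[ℂ] H, Continuous S ∧ ∀ v E F, ⟪F, S v E⟫_ℂ =
      wform M.Ωc (fun x => P.σ₀ + (κ v : E3 → ℝ) x) (field M (γ E)) (field M (γ F)) := by
  have hκ : ∀ v, (κ v : E3 → ℝ) ∈ conductivitySpace M := fun v => (κ v).2
  have hm : ∀ c : Coef M, MemLp (field M c) 2 (volume.restrict M.Ωc) := fun c => memLp_field c _ _
  obtain ⟨S₀, hS₀⟩ := exists_operator_of_wform γ (isBoundedWeight_const M.Ωc P.σ₀)
  have hL : ∀ v : V, ∃ B : H →L[ℂ] H, ∀ E F, ⟪F, B E⟫_ℂ =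
      wform M.Ωc (κ v : E3 → ℝ) (field M (γ E)) (field M (γ F)) := fun v =>
    exists_operator_of_wform γ (isBoundedWeight_of_conductivity (hκ v))
  choose L hL using hL
  let Ll : V →ₗ[ℝ] (H →L[ℂ] H) :=
    { toFun := L
      map_add' := fun v v' => by
        ext1 E
        refine ext_inner_left ℂ fun F => ?_
        rw [add_apply, inner_add_right, hL, hL, hL, map_add]
        exact wform_add_weight (isBoundedWeight_of_conductivity (hκ v))
          (isBoundedWeight_of_conductivity (hκ v')) (hm _) (hm _)
      map_smul' := fun r v => by
        ext1 E
        refine ext_inner_left ℂ fun F => ?_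
        rw [RingHom.id_apply, smul_apply, ← Complex.coe_smul, inner_smul_right, hL, hL, map_smul]
        exact wform_const_mul_weight r }
  refine ⟨fun v => S₀ + Ll v, continuous_const.add Ll.continuous_of_finiteDimensional,
    fun v E F => ?_⟩
  rw [wform_add_weight (isBoundedWeight_const _ _) (isBoundedWeight_of_conductivity (hκ v))
    (hm _) (hm _), ← hS₀, ← hL, ← inner_add_right]
  rfl

/-- For every `c < 1`, admissible conductivities near a given one have a total conductivity of at
least `c` times the given total conductivity. Where the latter is positive at a vertex this is
continuity; where it vanishes it is the sign condition on admissible conductivities. -/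
theorem eventually_isPositive_sub [FiniteDimensional ℝ V] {γ : H →ₗ[ℂ] Coef M}
    {κ : V ≃ₗ[ℝ] condSubmodule M}
    (hP : P.Admissible M) {S : V → H →L[ℂ] H}
    (hS : ∀ v E F, ⟪F, S v E⟫_ℂ =
      wform M.Ωc (fun x => P.σ₀ + (κ v : E3 → ℝ) x) (field M (γ E)) (field M (γ F)))
    {σmin : ℝ} (hσmin : 0 ≤ σmin) {v : V} (hv : (κ v : E3 → ℝ) ∈ admissibleSet M P σmin) {c : ℝ}
    (hc1 : c < 1) :
    ∀ᶠ v' in 𝓝[{v | (κ v : E3 → ℝ) ∈ admissibleSet M P σmin}] v,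
      (S v' - (c : ℂ) • S v).IsPositive := by
  have hvert : ∀ᶠ v' in 𝓝[{v | (κ v : E3 → ℝ) ∈ admissibleSet M P σmin}] v,
      ∀ T ∈ M.conductor, ∀ x ∈ T, c * (P.σ₀ + (κ v : E3 → ℝ) x) ≤ P.σ₀ + (κ v' : E3 → ℝ) x := by
    rw [Filter.eventually_all_finset]
    intro T _
    rw [Filter.eventually_all_finset]
    intro x _
    rcases (total_conductivity_nonneg hP hσmin hv x).eq_or_lt with h0 | hpos
    · filter_upwards [self_mem_nhdsWithin] with v' hv'
      rw [← h0, mul_zero]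
      exact total_conductivity_nonneg hP hσmin hv' x
    · have hlt : c * (P.σ₀ + (κ v : E3 → ℝ) x) < P.σ₀ + (κ v : E3 → ℝ) x :=
        mul_lt_of_lt_one_left hpos hc1
      have hcont : Continuous fun v' : V => P.σ₀ + (κ v' : E3 → ℝ) x :=
        continuous_const.add (continuous_eval κ x)
      exact ((hcont.tendsto v).eventually (le_mem_nhds hlt)).filter_mono nhdsWithin_le_nhds
  filter_upwards [hvert] with v' hv'
  refine isPositive_sub_of_weights (isBoundedWeight_total (κ v).2) (isBoundedWeight_total (κ v').2)
    (hS v) (hS v') ?_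
  rw [ae_restrict_iff' TetMesh.isOpen_Ωc.measurableSet]
  exact Eventually.of_forall fun x hx =>
    le_on_Ωc_of_le_on_vertices (κ v).2 (κ v').2 c P.σ₀ hv' hx

/-- The objective is a sum of two squared Hilbert space norms, of an affine function of the field
and of a linear and injective function of the conductivity. -/
theorem exists_objective_maps (γ : H →ₗ[ℂ] Coef M) (κ : V ≃ₗ[ℝ] condSubmodule M)
    [IsFiniteMeasure (surface Γ)] {n : E3 → E3} (hn : AEStronglyMeasurable n (surface Γ))
    (hn1 : ∀ᵐ x ∂(surface Γ), ‖n x‖ = 1) {Eobs : E3 → C3}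
    (hEobs : MemLp (fun x => toC3 (n x) ⨯₃ Eobs x) 2 (surface Γ)) (α : ℝ) :
    ∃ (T : H →ₗ[ℂ] Lp (EuclideanSpace ℂ (Fin 3)) 2 (surface Γ))
      (d : Lp (EuclideanSpace ℂ (Fin 3)) 2 (surface Γ))
      (G : V →ₗ[ℝ] Lp E3 2 (volume.restrict M.Ωc)), Function.Injective G ∧
      ∀ v e, objective M Γ n Eobs α (κ v) (field M (γ e)) =
        1 / 2 * ‖T e - d‖ ^ 2 + α / 2 * ‖G v‖ ^ 2 := by
  have hκ : ∀ v, (κ v : E3 → ℝ) ∈ conductivitySpace M := fun v => (κ v).2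
  have hT : ∀ e : H, MemLp (fun x => (WithLp.toLp 2 (toC3 (n x) ⨯₃ field M (γ e) x) :
      EuclideanSpace ℂ (Fin 3))) 2 (surface Γ) := fun e =>
    memLp_toLp (memLp_trace hn hn1 (γ e))
  obtain ⟨T, hTe⟩ := exists_linearMap_Lp (𝕜 := ℂ) _ hT
    (fun e e' => Eventually.of_forall fun x => by
      simp only [map_add, Pi.add_apply, WithLp.toLp_add])
    (fun r e => Eventually.of_forall fun x => by
      simp only [map_smul, Pi.smul_apply, WithLp.toLp_smul])
  have hd := memLp_toLp hEobs
  have hG : ∀ v : V, MemLp (gradient (κ v : E3 → ℝ)) 2 (volume.restrict M.Ωc) := fun v =>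
    memLp_gradient (hκ v)
  obtain ⟨G, hGe⟩ := exists_linearMap_Lp (𝕜 := ℝ) _ hG
    (fun v v' => by rw [map_add]; exact gradient_add_ae (hκ v) (hκ v'))
    (fun r v => by rw [map_smul]; exact gradient_smul_ae (hκ v) r)
  refine ⟨T, hd.toLp _, G, ?_, fun v e => ?_⟩
  · rw [← LinearMap.ker_eq_bot, LinearMap.ker_eq_bot']
    intro v hv
    rw [hGe] at hv
    have hv0 := (hG v).coeFn_toLp.symm.trans (Lp.eq_zero_iff_ae_eq_zero.mp hv)
    exact κ.map_eq_zero_iff.mp (Subtype.ext (eq_zero_of_gradient_ae_eq_zero (hκ v) hv0))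
  · rw [hTe, hGe, ← MemLp.toLp_sub, norm_toLp_sq ℂ, norm_toLp_sq ℝ, objective]
    congr 3
    ext x
    rw [normSq3_eq, map_sub]
    rfl

/-- The reduced state problem in operator form, with a compatible load. -/
theorem exists_state_operators [FiniteDimensional ℂ H] (hconv : Convex ℝ M.Ω)
    (hΓ : Γ ⊆ frontier M.Ω) (hP : P.Admissible M) {γ : H →ₗ[ℂ] Coef M}
    (hγ : ∀ e, γ e ∈ edgeCoef M Γ) (κ : V ≃ₗ[ℝ] condSubmodule M) {S : V → H →L[ℂ] H}
    (hS : ∀ v E F, ⟪F, S v E⟫_ℂ =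
      wform M.Ωc (fun x => P.σ₀ + (κ v : E3 → ℝ) x) (field M (γ E)) (field M (γ F))) :
    ∃ (A : H →L[ℂ] H) (f : H), A.IsPositive ∧ (∀ F, A F = 0 → ⟪F, f⟫_ℂ = 0) ∧
      ∀ v e, A e - (Complex.I * P.ω) • S v e = f ↔
        ∀ F, coefForm M P (κ v) (γ e) (γ F) = coefLoad M P (γ F) := by
  obtain ⟨A, hA⟩ := exists_operator_of_wform (curlCoef M ∘ₗ γ) (isBoundedWeight_μ hP)
  obtain ⟨f, hf⟩ := exists_riesz (fun F : H => coefLoad M P (γ F))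
    (fun F F' => by rw [map_add, coefLoad_add hP]) (fun r F => by rw [map_smul, coefLoad_smul])
  refine ⟨A, f, isPositive_of_wform hA ((μ_inv_pos hP).mono fun x hx => hx.le), fun F hF => ?_,
    fun v e => ?_⟩
  · have h1 := hA F F
    rw [hF, inner_zero_right] at h1
    have h2 := eq_zero_of_wform_self (isBoundedWeight_μ hP) (μ_inv_pos hP) (memLp_field _ _ _)
      h1.symm
    rw [hf, coefLoad, integral_source_field_eq_zero hconv hΓ hP (hγ F)
      (coef_eq_zero_of_field_ae h2), mul_zero]
  · have h1 : ∀ F : H, ⟪F, A e - (Complex.I * P.ω) • S v e⟫_ℂ =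
        coefForm M P (κ v) (γ e) (γ F) := by
      intro F
      rw [inner_sub_right, inner_smul_right, hA, hS]; rfl
    constructor
    · intro h F
      rw [← h1, h, hf]
    · intro h
      refine ext_inner_left ℂ fun F => ?_
      rw [h1, h, hf]

end Parametrisation

end Problem

end EddyCurrent

end

open EddyCurrent Filter in
theorem mainTheorem11
    (M : EddyCurrent.TetMesh) (hconv : Convex ℝ M.Ω)
    (Γ : Set EddyCurrent.E3) (hΓ : ∃ O : Set EddyCurrent.E3, IsOpen O ∧ Γ = O ∩ frontier M.Ω)
    (n : EddyCurrent.E3 → EddyCurrent.E3)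
    (hn_meas : AEStronglyMeasurable n (EddyCurrent.surface Γ))
    (hn : ∀ᵐ x ∂(EddyCurrent.surface Γ), EddyCurrent.IsOutwardUnitNormal M.Ω x (n x))
    (P : EddyCurrent.Coefficients) (hP : P.Admissible M)
    (Eobs : EddyCurrent.E3 → EddyCurrent.C3)
    (hEobs : MemLp (fun x => EddyCurrent.toC3 (n x) ⨯₃ Eobs x) 2 (EddyCurrent.surface Γ))
    (α : ℝ) (hα : 0 < α)
    (σmin : ℝ) (hσmin : 0 ≤ σmin) (hσmin' : σmin ≤ P.σ₀) :
    (∀ σ ∈ EddyCurrent.admissibleSet M P σmin, ∃ E φ,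
      EddyCurrent.IsDiscreteState M Γ P σ E φ) ∧
    ∃ σ ∈ EddyCurrent.admissibleSet M P σmin, ∃ E φ,
      EddyCurrent.IsDiscreteState M Γ P σ E φ ∧
      ∀ σ' ∈ EddyCurrent.admissibleSet M P σmin, ∀ E' φ',
        EddyCurrent.IsDiscreteState M Γ P σ' E' φ' →
        EddyCurrent.objective M Γ n Eobs α σ E ≤ EddyCurrent.objective M Γ n Eobs α σ' E' := by
  have hΓ' : Γ ⊆ frontier M.Ω := by
    obtain ⟨O, -, rfl⟩ := hΓ
    exact inter_subset_right
  have hfinΓ : IsFiniteMeasure (surface Γ) := isFiniteMeasure_surface M hΓ'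
  obtain ⟨N, γ, hγ, hstate, hstate'⟩ := exists_constrained_space M Γ hP
  let V := EuclideanSpace ℝ (Fin (Module.finrank ℝ (condSubmodule M)))
  let κ : V ≃ₗ[ℝ] condSubmodule M := LinearEquiv.ofFinrankEq _ _ (by simp [V])
  have hκ : ∀ v, (κ v : E3 → ℝ) ∈ conductivitySpace M := fun v => (κ v).2
  have hκ' : ∀ σ ∈ conductivitySpace M, ∃ v, (κ v : E3 → ℝ) = σ := fun σ hσ =>
    ⟨κ.symm ⟨σ, hσ⟩, by simp⟩
  have hKne : {v | (κ v : E3 → ℝ) ∈ admissibleSet M P σmin}.Nonempty := by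
    refine ⟨0, hκ 0, fun x _ => ?_⟩
    rw [map_zero]
    simpa using hσmin'
  obtain ⟨S, hScont, hS⟩ := exists_conductivity_operators γ κ P
  have hSpos : ∀ v ∈ {v | (κ v : E3 → ℝ) ∈ admissibleSet M P σmin}, (S v).IsPositive :=
    fun v hv => isPositive_of_wform (hS v)
      (Eventually.of_forall fun x => total_conductivity_nonneg hP hσmin hv x)
  obtain ⟨A, f, hApos, hf0, hop⟩ := exists_state_operators hconv hΓ' hP hγ κ hS
  obtain ⟨T, d, G, hG, hobj⟩ := exists_objective_maps (Γ := Γ) γ κ hn_meas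
    (hn.mono fun x hx => hx.1) hEobs α
  obtain ⟨v, hv, e, he, hmin⟩ := exists_minimizer hApos hScont (isClosed_admissible κ P σmin) hKne
    hSpos (fun v hv c hc => eventually_isPositive_sub hP hS hσmin hv hc) hP.ω_pos hf0
    T d G hG hα
  refine ⟨fun σ hσ => ?_, κ v, hv, field M (γ e), ?_⟩
  · obtain ⟨v, rfl⟩ := hκ' σ hσ.1
    obtain ⟨e, he⟩ := exists_state hApos (hSpos v hσ) P.ω hf0
    exact ⟨_, hstate' _ (hκ v) e ((hop v e).mp he)⟩
  · obtain ⟨φ, hφ⟩ := hstate' _ (hκ v) e ((hop v e).mp he)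
    refine ⟨φ, hφ, fun σ' hσ' E' φ' hst => ?_⟩
    obtain ⟨v', rfl⟩ := hκ' σ' hσ'.1
    obtain ⟨e', rfl, he'⟩ := hstate _ E' φ' hst
    rw [hobj, hobj]
    exact hmin v' hσ' e' ((hop v' e').mpr he')
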